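/- Let $k$ be a commutative ring. For an object $A$ of a $k$-linear category $\mathfrak a$, a sieve on $A$ is a submodule $R\subseteq \mathfrak a(-,A)$ of the representable $k$-linear functor. A $k$-linear topology $\mathcal T$ on $\mathfrak a$ specifies for every $A$ a collection $\mathcal T(A)$ of covering sieves on $A$ such that: $\mathfrak a(-,A)\in\mathcal T(A)$; if $R\in\mathcal T(A)$ and $f:A'\to A$, then $f^{-1}R\in\mathcal T(A')$; and if $R\in\mathcal T(A)$ and $S$ is a sieve on $A$ with $f^{-1}S\in\mathcal T(A')$ for all $f:A'\to A$ in $R$, then $S\in\mathcal T(A)$. A $k$-linear site is a small $k$-linear category with a $k$-linear topology. A family of morphisms with common target is covering if the sieve it generates is covering. $\mathsf{Sh}(\mathfrak a,\mathcal T)$ is the full subcategory of the $k$-linear functors $F:\mathfrak a^{\mathrm{op}}\to\mathsf{Mod}(k)$ for which $\mathrm{Hom}(\mathfrak a(-,A),F)\to \mathrm{Hom}(R,F)$ is bijective for all $A$ and $R\in\mathcal T(A)$. The category $\mathfrak a\otimes\mathfrak b$ has as objects the pairs $(A,B)$, and $(\mathfrak a\otimes\mathfrak b)((A,B),(A',B'))=\mathfrak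 a(A,A')\otimes_k\mathfrak b(B,B')$. For sieves $R$ on $A$ and $S$ on $B$, let $R\boxtimes S$ be the image of $R\otimes S\to\mathfrak a(-,A)\otimes\mathfrak b(-,B)$. Then $\mathcal T_{\mathfrak a}\boxtimes\mathcal T_{\mathfrak b}$ is the smallest $k$-linear topology on $\mathfrak a\otimes\mathfrak b$ containing all sieves $R\boxtimes\mathfrak b(-,B)$ with $R\in\mathcal T_{\mathfrak a}$ and all sieves $\mathfrak a(-,A)\boxtimes S$ with $S\in\mathcal T_{\mathfrak b}$. Let $\mathcal C$ be a $k$-linear Grothendieck category; call a sieve on an object of $\mathcal C$ covering if it is jointly epimorphic. An LC morphism $u:(\mathfrak a,\mathcal T_{\mathfrak a})\to\mathcal C$ from a $k$-linear site is a $k$-linear functor $u:\mathfrak a\to\mathcal C$ such that (G) every object $X$ of $\mathcal C$ has a covering family $(u(A_i)\to X)_i$; (F) for every $c:u(A)\to u(A')$ there are a covering family $(a_i:A_i\to A)_i$ for $\mathcal T_{\mathfrak a}$ and morphisms $f_i:A_i\to A'$ with $c\,u(a_i)=u(f_i)$; (FF) for every $a:A\to A'$ with $u(a)=0$ there is a covering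 family $(a_i:A_i\to A)_i$ for $\mathcal T_{\mathfrak a}$ with $a a_i=0$; and a sieve $R$ on $A$ is in $\mathcal T_{\mathfrak a}$ if and only if the sieve on $u(A)$ generated by the $u(f)$, $f\in R$, is covering. Proposition. Let $\mathcal C$ and $\mathcal D$ be $k$-linear Grothendieck categories. (1) For all LC morphisms $u:(\mathfrak a,\mathcal T_{\mathfrak a})\to\mathcal C$, $u':(\mathfrak a',\mathcal T_{\mathfrak a'})\to\mathcal C$, $v:(\mathfrak b,\mathcal T_{\mathfrak b})\to\mathcal D$ and $v':(\mathfrak b',\mathcal T_{\mathfrak b'})\to\mathcal D$ there is a $k$-linear equivalence of categories $$\mathsf{Sh}(\mathfrak a\otimes\mathfrak b,\mathcal T_{\mathfrak a}\boxtimes\mathcal T_{\mathfrak b})\cong\mathsf{Sh}(\mathfrak a'\otimes\mathfrak b',\mathcal T_{\mathfrak a'}\boxtimes\mathcal T_{\mathfrak b'}).$$ (2) Hence the tensor product $\mathcal C\boxtimes\mathcal D$ is well defined up to $k$-linear equivalence: there is a $k$-linear category that is $k$-linearly equivalent to $\mathsf{Sh}(\mathfrak a\otimes\mathfrak b,\mathcal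 T_{\mathfrak a}\boxtimes\mathcal T_{\mathfrak b})$ for some LC morphisms $(\mathfrak a,\mathcal T_{\mathfrak a})\to\mathcal C$ and $(\mathfrak b,\mathcal T_{\mathfrak b})\to\mathcal D$, and any two such categories are $k$-linearly equivalent. -/

import Mathlib

open CategoryTheory Opposite
open scoped TensorProduct

universe w v v₁ v₂ v₃ v₄ u u₁ u₂ u₃ u₄

namespace LinSite

section Sieves

/-- A linear sieve on `X` in a `k`-linear category: a `k`-submodule `R ⊆ C(-, X)` of the
representable module, i.e. a submodule of every `C(Y, X)`, stable under precomposition. -/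
@[ext]
structure LinearSieve (k : Type w) [CommRing k] {C : Type u} [Category.{v} C] [Preadditive C]
    [Linear k C] (X : C) where
  arrows : ∀ Y : C, Submodule k (Y ⟶ X)
  precomp_mem : ∀ {Y Z : C} {f : Y ⟶ X} (g : Z ⟶ Y), f ∈ arrows Y → g ≫ f ∈ arrows Z

namespace LinearSieve

variable {k : Type w} [CommRing k] {C : Type u} [Category.{v} C] [Preadditive C] [Linear k C]

/-- The maximal sieve `C(-, X)`. -/
def maximal (k : Type w) [CommRing k] {C : Type u} [Category.{v} C] [Preadditive C] [Linear k C]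
    (X : C) : LinearSieve k X where
  arrows _ := ⊤
  precomp_mem _ _ := Submodule.mem_top

/-- The pullback `f⁻¹ R = {g | f ∘ g ∈ R}` of a sieve `R` on `X` along `f : Y ⟶ X`. -/
def pullback {X Y : C} (R : LinearSieve k X) (f : Y ⟶ X) : LinearSieve k Y where
  arrows Z := (R.arrows Z).comap (Linear.rightComp k Z f)
  precomp_mem {Z W g} h hg := by
    have hg' : g ≫ f ∈ R.arrows Z := hg
    change (h ≫ g) ≫ f ∈ R.arrows W
    rw [Category.assoc]
    exact R.precomp_mem h hg'

/-- The sieve `⟨f i⟩` generated by a family of morphisms `f i : Y i ⟶ X`: its elements are the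
`k`-linear combinations of morphisms that factor through some `f i`. -/
def generate (k : Type w) [CommRing k] {C : Type u} [Category.{v} C] [Preadditive C] [Linear k C]
    {X : C} {ι : Type u₁} (Y : ι → C) (f : ∀ i, Y i ⟶ X) : LinearSieve k X where
  arrows Z := Submodule.span k {h : Z ⟶ X | ∃ (i : ι) (g : Z ⟶ Y i), g ≫ f i = h}
  precomp_mem {Z W h} e hh := by
    have key : Submodule.span k {h : Z ⟶ X | ∃ (i : ι) (g : Z ⟶ Y i), g ≫ f i = h} ≤
        (Submodule.span k {h : W ⟶ X | ∃ (i : ι) (g : W ⟶ Y i), g ≫ f i = h}).comap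
          (Linear.leftComp k X e) := by
      rw [Submodule.span_le]
      rintro _ ⟨i, g, rfl⟩
      exact Submodule.subset_span ⟨i, e ≫ g, by simp⟩
    exact key hh

/-- The image sieve `φ(R)` on `φ X` of a sieve `R` on `X`: the sieve generated by the morphisms
`φ f` with `f` in `R`. -/
def map {D : Type u₁} [Category.{v₁} D] [Preadditive D] [Linear k D] (φ : C ⥤ D) {X : C}
    (R : LinearSieve k X) : LinearSieve k (φ.obj X) :=
  generate k (fun f : Σ Y : C, R.arrows Y => φ.obj f.1) (fun f => φ.map f.2.1)

/-- A sieve on `X`, viewed as a `k`-linear functor `Cᵒᵖ ⥤ Mod(k)`. -/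
def toFunctor {X : C} (R : LinearSieve k X) : Cᵒᵖ ⥤ ModuleCat.{v} k where
  obj Y := ModuleCat.of k (R.arrows Y.unop)
  map {Y Z} g := ModuleCat.ofHom
    ((Linear.leftComp k X g.unop).restrict fun _ hf => R.precomp_mem g.unop hf)
  map_id Y := by
    refine ModuleCat.hom_ext (LinearMap.ext fun f => Subtype.ext ?_)
    exact Category.id_comp f.1
  map_comp g h := by
    refine ModuleCat.hom_ext (LinearMap.ext fun f => Subtype.ext ?_)
    exact Category.assoc h.unop g.unop f.1

/-- The inclusion of a sieve on `X` into the representable functor `C(-, X)`. -/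
def inclusion {X : C} (R : LinearSieve k X) : R.toFunctor ⟶ (linearYoneda k C).obj X where
  app Y := ModuleCat.ofHom (R.arrows Y.unop).subtype
  naturality _ _ _ := rfl

end LinearSieve

end Sieves

section Topologies

/-- A cover system: a collection of covering sieves on every object. -/
abbrev CoverSystem (k : Type w) [CommRing k] (C : Type u) [Category.{v} C] [Preadditive C]
    [Linear k C] : Type (max u v) :=
  ∀ X : C, Set (LinearSieve k X)

/-- A `k`-linear (Grothendieck) topology: a cover system satisfying the identity, pullback and
glueing axioms. -/
@[ext]
structure LinearTopology (k : Type w) [CommRing k] (C : Type u) [Category.{v} C] [Preadditive C]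
    [Linear k C] where
  covers : CoverSystem k C
  maximal_mem : ∀ X : C, LinearSieve.maximal k X ∈ covers X
  pullback_mem : ∀ {X Y : C} {R : LinearSieve k X} (f : Y ⟶ X),
    R ∈ covers X → R.pullback f ∈ covers Y
  glue_mem : ∀ {X : C} {R : LinearSieve k X} (S : LinearSieve k X), R ∈ covers X →
    (∀ (Y : C) (f : Y ⟶ X), f ∈ R.arrows Y → S.pullback f ∈ covers Y) → S ∈ covers X

variable {k : Type w} [CommRing k]

/-- The smallest linear topology that contains a given cover system. -/
def LinearTopology.generate {C : Type u} [Category.{v} C] [Preadditive C] [Linear k C]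
    (𝓡 : CoverSystem k C) : LinearTopology k C where
  covers X := {R | ∀ T : LinearTopology k C, (∀ Y, 𝓡 Y ⊆ T.covers Y) → R ∈ T.covers X}
  maximal_mem X T _ := T.maximal_mem X
  pullback_mem f hR T hT := T.pullback_mem f (hR T hT)
  glue_mem S hR hS T hT := T.glue_mem S (hR T hT) fun Y f hf => hS Y f hf T hT

variable {C : Type u} [Category.{v} C] [Preadditive C] [Linear k C]

/-- A family of morphisms with common target is covering if it generates a covering sieve. -/
def IsCoveringFamily (𝓣 : CoverSystem k C) {X : C} {ι : Type u₁} (Y : ι → C)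
    (f : ∀ i, Y i ⟶ X) : Prop :=
  LinearSieve.generate k Y f ∈ 𝓣 X

/-- The cover system `φ⁻¹ 𝓣`: a sieve `R` is covering if and only if `φ(R)` is. -/
def CoverSystem.preimage {D : Type u₁} [Category.{v₁} D] [Preadditive D] [Linear k D]
    (φ : C ⥤ D) (𝓣 : CoverSystem k D) : CoverSystem k C :=
  fun X => {R | R.map φ ∈ 𝓣 (φ.obj X)}

/-- The cover system of jointly epimorphic sieves. When the coproduct `⨁ C_f` over the morphisms
`f : C_f ⟶ X` of `R` makes sense, this says that the canonical morphism `⨁ C_f ⟶ X` is epi. -/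
def jointlyEpiCovers (k : Type w) [CommRing k] (C : Type u) [Category.{v} C] [Preadditive C]
    [Linear k C] : CoverSystem k C :=
  fun X => {R | ∀ (Z : C) (g h : X ⟶ Z),
    (∀ (Y : C) (f : Y ⟶ X), f ∈ R.arrows Y → f ≫ g = f ≫ h) → g = h}

end Topologies

section LC

variable {k : Type w} [CommRing k] {A : Type u} [Category.{v} A] [Preadditive A] [Linear k A]
  {C : Type u₁} [Category.{v₁} C] [Preadditive C] [Linear k C]

/-- Condition (G): every object `X` of `C` has a covering family `(φ(A i) ⟶ X)_i`. -/
def SatisfiesG (φ : A ⥤ C) (𝓣C : CoverSystem k C) : Prop :=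
  ∀ X : C, ∃ (ι : Type (max u v₁)) (Y : ι → A) (f : ∀ i, φ.obj (Y i) ⟶ X),
    IsCoveringFamily 𝓣C (fun i => φ.obj (Y i)) f

/-- Condition (F): every `c : φ(X) ⟶ φ(X')` is, locally on `X`, in the image of `φ`. -/
def SatisfiesF (𝓣A : CoverSystem k A) (φ : A ⥤ C) : Prop :=
  ∀ (X X' : A) (c : φ.obj X ⟶ φ.obj X'),
    ∃ (ι : Type (max u v)) (Y : ι → A) (a : ∀ i, Y i ⟶ X) (f : ∀ i, Y i ⟶ X'),
      IsCoveringFamily 𝓣A Y a ∧ ∀ i, φ.map (a i) ≫ c = φ.map (f i)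

/-- Condition (FF): every `a : X ⟶ X'` with `φ(a) = 0` is locally zero. -/
def SatisfiesFF (𝓣A : CoverSystem k A) (φ : A ⥤ C) : Prop :=
  ∀ (X X' : A) (a : X ⟶ X'), φ.map a = 0 →
    ∃ (ι : Type (max u v)) (Y : ι → A) (b : ∀ i, Y i ⟶ X),
      IsCoveringFamily 𝓣A Y b ∧ ∀ i, b i ≫ a = 0

/-- Condition (LC) for a functor `φ : (A, 𝓣A) ⥤ (C, 𝓣C)`. -/
structure SatisfiesLC (𝓣A : CoverSystem k A) (𝓣C : CoverSystem k C) (φ : A ⥤ C) : Prop where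
  satisfiesG : SatisfiesG φ 𝓣C
  satisfiesF : SatisfiesF 𝓣A φ
  satisfiesFF : SatisfiesFF 𝓣A φ
  eq_preimage : 𝓣A = CoverSystem.preimage φ 𝓣C

/-- An LC morphism from the linear site `(A, T)` to `C`: a `k`-linear functor that satisfies (LC)
with respect to the topology of jointly epimorphic sieves on `C`. -/
structure IsLCMorphism (T : LinearTopology k A) (φ : A ⥤ C) : Prop where
  additive : φ.Additive
  linear : φ.Linear k
  satisfiesLC : SatisfiesLC T.covers (jointlyEpiCovers k C) φ

end LC

section Sheaves

variable {k : Type w} [CommRing k] {A : Type u} [Category.{v} A] [Preadditive A] [Linear k A]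

/-- `F : Aᵒᵖ ⥤ Mod(k)` is a sheaf for `T`: it is `k`-linear, and for all covering sieves `R` on `X`,
restriction along `R ⊆ A(-, X)` is a bijection `Hom(A(-, X), F) → Hom(R, F)`. -/
structure IsLinearSheaf (T : LinearTopology k A) (F : Aᵒᵖ ⥤ ModuleCat.{v} k) : Prop where
  additive : F.Additive
  map_smul : ∀ {X Y : A} (r : k) (f : X ⟶ Y), F.map (r • f).op = r • F.map f.op
  bijective : ∀ (X : A) (R : LinearSieve k X), R ∈ T.covers X →
    Function.Bijective
      (fun α : (linearYoneda k A).obj X ⟶ F => R.inclusion ≫ α)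

/-- The category `Sh(A, T)` of linear sheaves: a full subcategory of `Aᵒᵖ ⥤ Mod(k)`. -/
abbrev Sh (T : LinearTopology k A) : Type (max u (v + 1) w) :=
  ObjectProperty.FullSubcategory (IsLinearSheaf T)

end Sheaves

section Tensor

/-- The tensor product `A ⊗ B` of `k`-linear categories: objects are pairs, and
`(A ⊗ B)((X, Y), (X', Y')) = A(X, X') ⊗[k] B(Y, Y')`. -/
structure TensorCat (k : Type w) (A : Type u₁) (B : Type u₂) where
  fst : A
  snd : B

variable {k : Type w} [CommRing k] {A : Type u₁} [Category.{v₁} A] [Preadditive A] [Linear k A]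
  {B : Type u₂} [Category.{v₂} B] [Preadditive B] [Linear k B]

namespace TensorCat

instance : Quiver (TensorCat k A B) where
  Hom P Q := (P.fst ⟶ Q.fst) ⊗[k] (P.snd ⟶ Q.snd)

instance (P Q : TensorCat k A B) : AddCommGroup (P ⟶ Q) :=
  inferInstanceAs (AddCommGroup ((P.fst ⟶ Q.fst) ⊗[k] (P.snd ⟶ Q.snd)))

instance (P Q : TensorCat k A B) : Module k (P ⟶ Q) :=
  inferInstanceAs (Module k ((P.fst ⟶ Q.fst) ⊗[k] (P.snd ⟶ Q.snd)))

/-- The pure tensor `f ⊗ g` as a morphism of `A ⊗ B`. -/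
def tmulHom {P Q : TensorCat k A B} (f : P.fst ⟶ Q.fst) (g : P.snd ⟶ Q.snd) : P ⟶ Q :=
  (f ⊗ₜ[k] g : (P.fst ⟶ Q.fst) ⊗[k] (P.snd ⟶ Q.snd))

/-- Composition in `A ⊗ B`, the bilinear extension of
`(f ⊗ g) ≫ (f' ⊗ g') = (f ≫ f') ⊗ (g ≫ g')`. -/
def compHom (P Q S : TensorCat k A B) : (P ⟶ Q) →ₗ[k] (Q ⟶ S) →ₗ[k] (P ⟶ S) :=
  TensorProduct.map₂ (Linear.comp (S := k) P.fst Q.fst S.fst)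
    (Linear.comp (S := k) P.snd Q.snd S.snd)

lemma compHom_tmulHom {P Q S : TensorCat k A B} (f : P.fst ⟶ Q.fst) (g : P.snd ⟶ Q.snd)
    (f' : Q.fst ⟶ S.fst) (g' : Q.snd ⟶ S.snd) :
    compHom P Q S (tmulHom f g) (tmulHom f' g') = tmulHom (f ≫ f') (g ≫ g') := rfl

lemma hom_induction {P Q : TensorCat k A B} {motive : (P ⟶ Q) → Prop} (h : P ⟶ Q)
    (tmul : ∀ (f : P.fst ⟶ Q.fst) (g : P.snd ⟶ Q.snd), motive (tmulHom f g))
    (add : ∀ a b : P ⟶ Q, motive a → motive b → motive (a + b)) : motive h := by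
  refine TensorProduct.induction_on (motive := motive) h ?_ tmul add
  have h0 := tmul 0 0
  rwa [show tmulHom (0 : P.fst ⟶ Q.fst) (0 : P.snd ⟶ Q.snd) = (0 : P ⟶ Q) from
    TensorProduct.zero_tmul _ _] at h0

instance : Category (TensorCat k A B) where
  id P := tmulHom (𝟙 P.fst) (𝟙 P.snd)
  comp {P Q S} f g := compHom P Q S f g
  id_comp f := by
    induction f using hom_induction with
    | tmul f g => rw [compHom_tmulHom, Category.id_comp, Category.id_comp]
    | add a b ha hb => rw [map_add, ha, hb]
  comp_id f := by
    induction f using hom_induction with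
    | tmul f g => rw [compHom_tmulHom, Category.comp_id, Category.comp_id]
    | add a b ha hb => rw [map_add, LinearMap.add_apply, ha, hb]
  assoc f g h := by
    induction f using hom_induction with
    | add a b ha hb => simp only [map_add, LinearMap.add_apply, ha, hb]
    | tmul f₁ f₂ =>
      induction g using hom_induction with
      | add a b ha hb => simp only [map_add, LinearMap.add_apply, ha, hb]
      | tmul g₁ g₂ =>
        induction h using hom_induction with
        | add a b ha hb => simp only [map_add, ha, hb]
        | tmul h₁ h₂ => simp only [compHom_tmulHom, Category.assoc]

instance : Preadditive (TensorCat k A B) where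
  homGroup P Q := inferInstance
  add_comp P Q S f f' g := by
    change compHom P Q S (f + f') g = compHom P Q S f g + compHom P Q S f' g
    rw [map_add, LinearMap.add_apply]
  comp_add P Q S f g g' := map_add (compHom P Q S f) g g'

instance : Linear k (TensorCat k A B) where
  homModule P Q := inferInstanceAs (Module k ((P.fst ⟶ Q.fst) ⊗[k] (P.snd ⟶ Q.snd)))
  smul_comp P Q S r f g := by
    change compHom P Q S (r • f) g = r • compHom P Q S f g
    rw [map_smul, LinearMap.smul_apply]
  comp_smul P Q S f r g := map_smul (compHom P Q S f) r g

end TensorCat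

/-- The tensor product sieve `R ⊠ S`, the image of `R ⊗ S → A(-, X) ⊗ B(-, Y)`. -/
def LinearSieve.tensor {X : A} {Y : B} (R : LinearSieve k X) (S : LinearSieve k Y) :
    LinearSieve k (TensorCat.mk X Y : TensorCat k A B) where
  arrows P := LinearMap.range
    (TensorProduct.map (R.arrows P.fst).subtype (S.arrows P.snd).subtype)
  precomp_mem {P Q f} g hf := by
    obtain ⟨t, rfl⟩ := hf
    induction t using TensorProduct.induction_on with
    | zero =>
      rw [map_zero]
      exact (Limits.comp_zero (f := g)).symm ▸ Submodule.zero_mem _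
    | add a b ha hb =>
      rw [map_add]
      exact (Preadditive.comp_add _ _ _ g _ _).symm ▸ Submodule.add_mem _ ha hb
    | tmul a b =>
      induction g using TensorCat.hom_induction with
      | add g g' hg hg' =>
        exact (Preadditive.add_comp _ _ _ g g' _).symm ▸ Submodule.add_mem _ hg hg'
      | tmul g g' =>
        exact ⟨⟨g ≫ a.1, R.precomp_mem g a.2⟩ ⊗ₜ[k] ⟨g' ≫ b.1, S.precomp_mem g' b.2⟩, rfl⟩

/-- The cover system of all `R ⊠ B(-, Y)` with `R` covering for `TA`, and all `A(-, X) ⊠ S` with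
`S` covering for `TB`. -/
def tensorCovers (TA : LinearTopology k A) (TB : LinearTopology k B) :
    CoverSystem k (TensorCat k A B) :=
  fun P => {Q | (∃ R ∈ TA.covers P.fst, Q = R.tensor (LinearSieve.maximal k P.snd)) ∨
    ∃ S ∈ TB.covers P.snd, Q = (LinearSieve.maximal k P.fst).tensor S}

/-- The tensor product topology `TA ⊠ TB` on `A ⊗ B`. -/
def LinearTopology.tensor (TA : LinearTopology k A) (TB : LinearTopology k B) :
    LinearTopology k (TensorCat k A B) :=
  LinearTopology.generate (tensorCovers TA TB)

end Tensor

section TensorProduct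

/-- `C` and `D` are equivalent as `k`-linear categories. -/
def LinearlyEquivalent (k : Type w) [CommRing k] (C : Type u₁) [Category.{v₁} C] [Preadditive C]
    [Linear k C] (D : Type u₂) [Category.{v₂} D] [Preadditive D] [Linear k D] : Prop :=
  ∃ e : C ≌ D, e.functor.Additive ∧ e.functor.Linear k

/-- `E` is a tensor product `C ⊠ D`: it is equivalent to `Sh(A ⊗ B, TA ⊠ TB)` for some LC morphisms
`u : (A, TA) ⥤ C` and `v : (B, TB) ⥤ D` from small linear sites. -/
def IsTensorProduct (k : Type w) [CommRing k] (C : Type u₁) [Category.{v₁} C] [Preadditive C]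
    [Linear k C] (D : Type u₂) [Category.{v₂} D] [Preadditive D] [Linear k D]
    (E : Type u₃) [Category.{v₃} E] [Preadditive E] [Linear k E] : Prop :=
  ∃ (A : Type w) (_ : SmallCategory A) (_ : Preadditive A) (_ : Linear k A)
    (B : Type w) (_ : SmallCategory B) (_ : Preadditive B) (_ : Linear k B)
    (TA : LinearTopology k A) (TB : LinearTopology k B) (F : A ⥤ C) (G : B ⥤ D),
    IsLCMorphism TA F ∧ IsLCMorphism TB G ∧ LinearlyEquivalent k E (Sh (TA.tensor TB))

end TensorProduct

end LinSite

/-! Both sheaf categories in (1) are compared with one that does not depend on the chosen sites: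
sheaves on `C ⊗ D`, where `C` and `D` carry the topology of jointly epimorphic sieves (after
shrinking hom sets to `Type w`). Three facts carry the argument.

Comparison lemma. If `φ : P ⥤ Q` is locally full, locally faithful, dense, cocontinuous and
preserves covering sieves (`IsDenseMorphism`), restriction along `φ` is an equivalence from sheaves
on `Q` to sheaves on `P`. Its inverse sends `F` to `Z ↦ Hom(Q(φ(-), Z), F)`; here `P` must be small,
while `Q` may be large.

LC morphisms are dense. For this, the jointly epimorphic sieves must form a topology, the pullback
axiom being the point at issue. By Gabriel–Popescu, a Grothendieck category is an exact reflective
localization of modules over `End G`, `G` a separator, and pullback stability is inherited from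
there.

Tensor products of dense morphisms are dense (`IsDenseMorphism.tensor`). The delicate condition is
local faithfulness, as tensoring over `k` does not preserve kernels. If `φ ⊗ N` kills `t`, lift `t`
along a free cover of `N`. The obstruction to the lift being killed lives in the kernel of the cover
tensored with morphisms of the target; it can be lifted locally by local fullness and subtracted.
What remains is killed over a flat module, where local faithfulness of `φ` suffices
(`tensorAnnihilator_mem`).

Existence in (2) follows from the full subcategory on a separator, whose inclusion is an LC
morphism. -/

namespace LinSite

/-! ### Order and functoriality of linear sieves -/

namespace LinearSieve

variable {k : Type w} [CommRing k] {C : Type u} [Category.{v} C] [Preadditive C] [Linear k C]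

instance (X : C) : LE (LinearSieve k X) where
  le R S := ∀ ⦃Y : C⦄ (f : Y ⟶ X), f ∈ R.arrows Y → f ∈ S.arrows Y

/-- The intersection of two sieves. -/
def inter {X : C} (R S : LinearSieve k X) : LinearSieve k X where
  arrows Y := R.arrows Y ⊓ S.arrows Y
  precomp_mem g hf := ⟨R.precomp_mem g hf.1, S.precomp_mem g hf.2⟩

lemma mem_pullback {X Y Z : C} {R : LinearSieve k X} {f : Y ⟶ X} {g : Z ⟶ Y} :
    g ∈ (R.pullback f).arrows Z ↔ g ≫ f ∈ R.arrows Z := Iff.rfl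

lemma pullback_id {X : C} (R : LinearSieve k X) : R.pullback (𝟙 X) = R := by
  ext Y f
  rw [mem_pullback, Category.comp_id]

lemma pullback_comp {X Y Z : C} (R : LinearSieve k X) (g : Z ⟶ Y) (f : Y ⟶ X) :
    R.pullback (g ≫ f) = (R.pullback f).pullback g := by
  ext W h
  rw [mem_pullback, mem_pullback, mem_pullback, Category.assoc]

lemma generate_le_iff {X : C} {ι : Type u₁} {Y : ι → C} {f : ∀ i, Y i ⟶ X}
    {S : LinearSieve k X} : generate k Y f ≤ S ↔ ∀ i, f i ∈ S.arrows (Y i) := by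
  refine ⟨fun h i => h _ (Submodule.subset_span ⟨i, 𝟙 _, Category.id_comp _⟩), fun h Z => ?_⟩
  change Submodule.span k _ ≤ S.arrows Z
  rw [Submodule.span_le]
  rintro _ ⟨i, g, rfl⟩
  exact S.precomp_mem g (h i)

lemma mem_generate {X : C} {ι : Type u₁} (Y : ι → C) (f : ∀ i, Y i ⟶ X) (i : ι) :
    f i ∈ (generate k Y f).arrows (Y i) :=
  generate_le_iff.1 (fun _ _ h => h) i

/-- The sieve of all morphisms annihilating `a`. -/
def annihilator (k : Type w) [CommRing k] {C : Type u} [Category.{v} C] [Preadditive C]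
    [Linear k C] {X Y : C} (a : X ⟶ Y) : LinearSieve k X where
  arrows Z := LinearMap.ker (Linear.rightComp k Z a)
  precomp_mem {Z W f} g hf := by
    have hf' : f ≫ a = 0 := hf
    change (g ≫ f) ≫ a = 0
    rw [Category.assoc, hf', Limits.comp_zero]

section Functor

variable {D : Type u₁} [Category.{v₁} D] [Preadditive D] [Linear k D] (φ : C ⥤ D)

lemma map_mem {X Y : C} {R : LinearSieve k X} {f : Y ⟶ X} (hf : f ∈ R.arrows Y) :
    φ.map f ∈ (R.map φ).arrows (φ.obj Y) :=
  mem_generate (k := k) (fun f : Σ Y : C, R.arrows Y => φ.obj f.1) (fun f => φ.map f.2.1)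
    ⟨Y, f, hf⟩

/-- The sieve on `Z` generated by all morphisms from objects in the image of `φ`. -/
def ofImage (k : Type w) [CommRing k] {C : Type u} [Category.{v} C] {D : Type u₁}
    [Category.{v₁} D] [Preadditive D] [Linear k D] (φ : C ⥤ D) (Z : D) : LinearSieve k Z :=
  generate k (fun i : Σ X : C, (φ.obj X ⟶ Z) => φ.obj i.1) (fun i => i.2)

omit [Preadditive C] [Linear k C] in
lemma ofImage_le_iff {φ : C ⥤ D} {Z : D} {S : LinearSieve k Z} :
    ofImage k φ Z ≤ S ↔ ∀ (X : C) (g : φ.obj X ⟶ Z), g ∈ S.arrows _ :=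
  generate_le_iff.trans ⟨fun h X g => h ⟨X, g⟩, fun h i => h i.1 i.2⟩

variable [φ.Additive] [φ.Linear k]

/-- The inverse image of a sieve along a linear functor. -/
def comap {X : C} (S : LinearSieve k (φ.obj X)) : LinearSieve k X where
  arrows Y := (S.arrows (φ.obj Y)).comap (φ.mapLinearMap k)
  precomp_mem {Y Z f} g hf := by
    change φ.map (g ≫ f) ∈ S.arrows _
    rw [φ.map_comp]
    exact S.precomp_mem _ hf

lemma map_le_iff {φ : C ⥤ D} [φ.Additive] [φ.Linear k] {X : C} {R : LinearSieve k X}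
    {S : LinearSieve k (φ.obj X)} : R.map φ ≤ S ↔ R ≤ S.comap φ :=
  generate_le_iff.trans ⟨fun h Y f hf => h ⟨Y, f, hf⟩, fun h i => h _ i.2.2⟩

/-- The sieve of all `h` such that `φ h ≫ c` lifts along `φ`. -/
def lifting (k : Type w) [CommRing k] {C : Type u} [Category.{v} C] [Preadditive C] [Linear k C]
    {D : Type u₁} [Category.{v₁} D] [Preadditive D] [Linear k D] (φ : C ⥤ D) [φ.Additive]
    [φ.Linear k] {X Y : C} (c : φ.obj X ⟶ φ.obj Y) : LinearSieve k X where
  arrows Z := (LinearMap.range (φ.mapLinearMap k (X := Z) (Y := Y))).comap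
    ((Linear.rightComp k (φ.obj Z) c).comp (φ.mapLinearMap k))
  precomp_mem {Z W f} g hf := by
    obtain ⟨e, he⟩ := hf
    have he' : φ.map e = φ.map f ≫ c := he
    refine ⟨g ≫ e, ?_⟩
    change φ.map (g ≫ e) = φ.map (g ≫ f) ≫ c
    rw [φ.map_comp, φ.map_comp, Category.assoc, he']

lemma mem_lifting {φ : C ⥤ D} [φ.Additive] [φ.Linear k] {X Y Z : C} {c : φ.obj X ⟶ φ.obj Y}
    {h : Z ⟶ X} : h ∈ (lifting k φ c).arrows Z ↔ ∃ e : Z ⟶ Y, φ.map e = φ.map h ≫ c := Iff.rfl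

end Functor

end LinearSieve

/-! ### Closure properties of linear topologies; transport along functors -/

namespace LinearTopology

variable {k : Type w} [CommRing k] {C : Type u} [Category.{v} C] [Preadditive C] [Linear k C]
  (T : LinearTopology k C)

lemma mem_of_le {X : C} {R S : LinearSieve k X} (h : R ≤ S) (hR : R ∈ T.covers X) :
    S ∈ T.covers X := by
  refine T.glue_mem S hR fun Y f hf => ?_
  convert! T.maximal_mem Y
  ext Z g
  exact ⟨fun _ => Submodule.mem_top, fun _ => S.precomp_mem g (h f hf)⟩

lemma inter_mem {X : C} {R S : LinearSieve k X} (hR : R ∈ T.covers X) (hS : S ∈ T.covers X) :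
    R.inter S ∈ T.covers X :=
  T.glue_mem _ hR fun _ f hf =>
    T.mem_of_le (fun _ g hg => ⟨R.precomp_mem g hf, hg⟩) (T.pullback_mem f hS)

lemma of_id_mem {X : C} {R : LinearSieve k X} (h : 𝟙 X ∈ R.arrows X) : R ∈ T.covers X :=
  T.mem_of_le (fun _ f _ => by simpa using R.precomp_mem f h) (T.maximal_mem X)

/-- The sieve of all morphisms along which the pullback of `S` is covering. -/
def closure {X : C} (S : LinearSieve k X) : LinearSieve k X where
  arrows Y :=
    { carrier := {f | S.pullback f ∈ T.covers Y}
      add_mem' := fun {f g} hf hg => T.mem_of_le (fun Z h hh => by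
        rw [LinearSieve.mem_pullback, Preadditive.comp_add]
        exact Submodule.add_mem _ hh.1 hh.2) (T.inter_mem hf hg)
      zero_mem' := T.mem_of_le (fun Z h _ => by
        rw [LinearSieve.mem_pullback, Limits.comp_zero]
        exact Submodule.zero_mem _) (T.maximal_mem Y)
      smul_mem' := fun r f hf => T.mem_of_le (fun Z h hh => by
        rw [LinearSieve.mem_pullback, Linear.comp_smul]
        exact Submodule.smul_mem _ r hh) hf }
  precomp_mem {Y Z f} g hf := by
    change S.pullback (g ≫ f) ∈ T.covers Z
    rw [LinearSieve.pullback_comp]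
    exact T.pullback_mem g hf

lemma mem_closure {X Y : C} {S : LinearSieve k X} {f : Y ⟶ X} :
    f ∈ (T.closure S).arrows Y ↔ S.pullback f ∈ T.covers Y := Iff.rfl

/-- The gluing axiom in a form adapted to generators: as `T.closure S` is itself a linear sieve, the
inclusion only has to be checked on morphisms generating `R`, not on their linear combinations. -/
lemma mem_of_le_closure {X : C} {R S : LinearSieve k X} (hR : R ∈ T.covers X)
    (h : R ≤ T.closure S) : S ∈ T.covers X :=
  T.glue_mem S hR fun _ f hf => h f hf

section Functor

variable {D : Type u₁} [Category.{v₁} D] [Preadditive D] [Linear k D] (φ : C ⥤ D)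
  [φ.Additive] [φ.Linear k]

/-- The finest linear topology on `D` for which `φ` is cocontinuous. -/
def pushforward : LinearTopology k D where
  covers Z := {R | ∀ (X : C) (g : φ.obj X ⟶ Z), (R.pullback g).comap φ ∈ T.covers X}
  maximal_mem Z X g := T.of_id_mem Submodule.mem_top
  pullback_mem f hR X g := by
    rw [← LinearSieve.pullback_comp]
    exact hR X _
  glue_mem {Z R} S hR hS X g := by
    refine T.glue_mem _ (hR X g) fun Y h hh => ?_
    -- Membership of `h` says that `φ.map h ≫ g` lies in `R`, so `hS` applies to this morphism; its
    -- instance at the identity of `φ.obj Y` is the required cover.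
    refine T.mem_of_le ?_ (hS _ (φ.map h ≫ g) hh Y (𝟙 _))
    intro W e he
    change φ.map (e ≫ h) ≫ g ∈ S.arrows _
    have he' : (φ.map e ≫ 𝟙 _) ≫ φ.map h ≫ g ∈ S.arrows _ := he
    simpa using he'

/-- The topology of all sieves on `C` such that the image under `φ` of every pullback is covering. -/
def continuity (T : LinearTopology k D) (φ : C ⥤ D) [φ.Additive] [φ.Linear k] :
    LinearTopology k C where
  -- Quantifying over all pullbacks builds in the pullback axiom, which need not hold for the
  -- condition on `R` alone.
  covers X := {R | ∀ (Y : C) (f : Y ⟶ X), (R.pullback f).map φ ∈ T.covers (φ.obj Y)}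
  maximal_mem X Y f := T.of_id_mem (by
    rw [← φ.map_id]
    exact LinearSieve.map_mem φ Submodule.mem_top)
  pullback_mem f hR Y g := by
    rw [← LinearSieve.pullback_comp]
    exact hR Y _
  glue_mem {X R} S hR hS Y f := by
    refine T.mem_of_le_closure (hR Y f) (LinearSieve.map_le_iff.2 fun Z g hg => ?_)
    refine T.mem_of_le ?_ (hS _ (g ≫ f) hg Z (𝟙 Z))
    refine LinearSieve.map_le_iff.2 fun W h hh => ?_
    change φ.map h ≫ φ.map g ∈ ((S.pullback f).map φ).arrows _
    rw [← φ.map_comp]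
    refine LinearSieve.map_mem φ ?_
    have hh' : (h ≫ 𝟙 Z) ≫ g ≫ f ∈ S.arrows _ := hh
    simpa [LinearSieve.mem_pullback] using hh'

end Functor

end LinearTopology

/-- A linear functor between linear sites satisfying the hypotheses of the comparison lemma: it is
locally full, locally faithful, dense, cocontinuous and preserves covering sieves. -/
structure IsDenseMorphism {k : Type w} [CommRing k] {P : Type u} [Category.{v} P] [Preadditive P]
    [Linear k P] {Q : Type u₁} [Category.{v₁} Q] [Preadditive Q] [Linear k Q]
    (T : LinearTopology k P) (T' : LinearTopology k Q) (φ : P ⥤ Q) [φ.Additive] [φ.Linear k] :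
    Prop where
  lifting_mem : ∀ {X Y : P} (c : φ.obj X ⟶ φ.obj Y), LinearSieve.lifting k φ c ∈ T.covers X
  annihilator_mem : ∀ {X Y : P} (a : X ⟶ Y), φ.map a = 0 →
    LinearSieve.annihilator k a ∈ T.covers X
  ofImage_mem : ∀ Z : Q, LinearSieve.ofImage k φ Z ∈ T'.covers Z
  comap_mem : ∀ {X : P} {R : LinearSieve k (φ.obj X)}, R ∈ T'.covers (φ.obj X) →
    R.comap φ ∈ T.covers X
  map_mem : ∀ {X : P} {R : LinearSieve k X}, R ∈ T.covers X → R.map φ ∈ T'.covers (φ.obj X)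

/-! ### Linear presheaves and sheaves in terms of sections -/

section Presheaves

variable {k : Type w} [CommRing k] {C : Type u} [Category.{v} C]

/-- The restriction map of a presheaf of modules along `f`. -/
def res (F : Cᵒᵖ ⥤ ModuleCat.{v₁} k) {X Y : C} (f : Y ⟶ X) : F.obj (op X) →ₗ[k] F.obj (op Y) :=
  (F.map f.op).hom

@[simp]
lemma res_id (F : Cᵒᵖ ⥤ ModuleCat.{v₁} k) {X : C} (x : F.obj (op X)) : res F (𝟙 X) x = x := by
  simp [res]

lemma res_comp (F : Cᵒᵖ ⥤ ModuleCat.{v₁} k) {X Y Z : C} (g : Z ⟶ Y) (f : Y ⟶ X)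
    (x : F.obj (op X)) : res F (g ≫ f) x = res F g (res F f x) := by
  simp [res]

/-- The component at `X` of a morphism of presheaves of modules, as a linear map. -/
def appₗ {F G : Cᵒᵖ ⥤ ModuleCat.{v₁} k} (α : F ⟶ G) (X : C) : F.obj (op X) →ₗ[k] G.obj (op X) :=
  (α.app (op X)).hom

lemma appₗ_res {F G : Cᵒᵖ ⥤ ModuleCat.{v₁} k} (α : F ⟶ G) {X Y : C} (f : Y ⟶ X)
    (x : F.obj (op X)) : appₗ α Y (res F f x) = res G f (appₗ α X x) :=
  NatTrans.naturality_apply α f.op x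

lemma hom_ext_appₗ {F G : Cᵒᵖ ⥤ ModuleCat.{v₁} k} {α β : F ⟶ G}
    (h : ∀ X x, appₗ α X x = appₗ β X x) : α = β := by
  ext X x
  exact h X.unop x

/-- Construct a morphism of presheaves of modules from a compatible family of linear maps. -/
def homMk {F G : Cᵒᵖ ⥤ ModuleCat.{v₁} k} (a : ∀ X : C, F.obj (op X) →ₗ[k] G.obj (op X))
    (h : ∀ (X Y : C) (f : Y ⟶ X) (x : F.obj (op X)), a Y (res F f x) = res G f (a X x)) :
    F ⟶ G where
  app X := ModuleCat.ofHom (a X.unop)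
  naturality X Y f := by
    ext x
    exact h X.unop Y.unop f.unop x

end Presheaves

section Linear

variable {k : Type w} [CommRing k] {C : Type u} [Category.{v} C] [Preadditive C] [Linear k C]

/-- A presheaf of modules on a linear category is linear if its restriction maps depend linearly
on the morphism. -/
def IsLinearPresheaf (F : Cᵒᵖ ⥤ ModuleCat.{v₁} k) : Prop :=
  ∀ ⦃X Y : C⦄ (r : k) (f g : Y ⟶ X) (x : F.obj (op X)),
    res F (r • f + g) x = r • res F f x + res F g x

namespace IsLinearPresheaf

variable {F : Cᵒᵖ ⥤ ModuleCat.{v₁} k}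

lemma res_add (hF : IsLinearPresheaf F) {X Y : C} (f g : Y ⟶ X) (x : F.obj (op X)) :
    res F (f + g) x = res F f x + res F g x := by
  simpa using hF (1 : k) f g x

lemma res_zero (hF : IsLinearPresheaf F) {X Y : C} (x : F.obj (op X)) :
    res F (0 : Y ⟶ X) x = 0 := by
  simpa using hF.res_add (0 : Y ⟶ X) 0 x

lemma res_smul (hF : IsLinearPresheaf F) {X Y : C} (r : k) (f : Y ⟶ X) (x : F.obj (op X)) :
    res F (r • f) x = r • res F f x := by
  simpa [hF.res_zero] using hF r f 0 x

/-- Evaluation of morphisms at an element of a linear presheaf. -/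
def resₗ (hF : IsLinearPresheaf F) {X : C} (x : F.obj (op X)) (Y : C) :
    (Y ⟶ X) →ₗ[k] F.obj (op Y) where
  toFun f := res F f x
  map_add' f g := hF.res_add f g x
  map_smul' r f := hF.res_smul r f x

@[simp]
lemma resₗ_apply (hF : IsLinearPresheaf F) {X : C} (x : F.obj (op X)) {Y : C} (f : Y ⟶ X) :
    hF.resₗ x Y f = res F f x := rfl

end IsLinearPresheaf

/-- The components of a morphism from a representable presheaf. -/
def evalHom {F : Cᵒᵖ ⥤ ModuleCat.{v} k} {X : C} (α : (linearYoneda k C).obj X ⟶ F) (Y : C) :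
    (Y ⟶ X) →ₗ[k] F.obj (op Y) := appₗ α Y

lemma evalHom_eq {F : Cᵒᵖ ⥤ ModuleCat.{v} k} {X Y : C} (α : (linearYoneda k C).obj X ⟶ F)
    (f : Y ⟶ X) : evalHom α Y f = res F f (evalHom α X (𝟙 X)) :=
  (congrArg (evalHom α Y) (Category.comp_id f).symm).trans (appₗ_res α f (𝟙 X))

lemma hom_ext_evalHom {F : Cᵒᵖ ⥤ ModuleCat.{v} k} {X : C} {α β : (linearYoneda k C).obj X ⟶ F}
    (h : evalHom α X (𝟙 X) = evalHom β X (𝟙 X)) : α = β :=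
  hom_ext_appₗ fun Y f => by
    refine (evalHom_eq α f).trans (Eq.trans ?_ (evalHom_eq β f).symm)
    rw [h]

/-- The morphism from a representable presheaf that corresponds to an element. -/
def IsLinearPresheaf.yonedaHom {F : Cᵒᵖ ⥤ ModuleCat.{v} k} (hF : IsLinearPresheaf F) {X : C}
    (x : F.obj (op X)) : (linearYoneda k C).obj X ⟶ F :=
  homMk (fun Y => hF.resₗ x Y) fun _ _ f g => res_comp F f g x

@[simp]
lemma IsLinearPresheaf.evalHom_yonedaHom {F : Cᵒᵖ ⥤ ModuleCat.{v} k} (hF : IsLinearPresheaf F)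
    {X Y : C} (x : F.obj (op X)) (f : Y ⟶ X) : evalHom (hF.yonedaHom x) Y f = res F f x := rfl

lemma isLinearPresheaf_linearYoneda (X : C) :
    IsLinearPresheaf ((linearYoneda k C).obj X) := by
  intro Y Z r f g x
  exact (Preadditive.add_comp _ _ _ (r • f) g x).trans
    (congrArg (· + _) (Linear.smul_comp _ _ _ r f x))

end Linear

namespace IsLinearSheaf

variable {k : Type w} [CommRing k] {C : Type u} [Category.{v} C] [Preadditive C] [Linear k C]
  {T : LinearTopology k C} {F : Cᵒᵖ ⥤ ModuleCat.{v} k}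

lemma isLinearPresheaf (hF : IsLinearSheaf T F) : IsLinearPresheaf F := by
  intro X Y r f g x
  have := hF.additive
  simp [res, hF.map_smul]

lemma eq_of_res_eq (hF : IsLinearSheaf T F) {X : C} {R : LinearSieve k X} (hR : R ∈ T.covers X)
    {x y : F.obj (op X)} (h : ∀ (Y : C) (f : Y ⟶ X), f ∈ R.arrows Y → res F f x = res F f y) :
    x = y := by
  have key : hF.isLinearPresheaf.yonedaHom x = hF.isLinearPresheaf.yonedaHom y := by
    refine (hF.bijective X R hR).1 (hom_ext_appₗ fun Y f => ?_)
    exact h Y f.1 f.2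
  simpa using congrArg (fun α => evalHom α X (𝟙 X)) key

lemma exists_res_eq (hF : IsLinearSheaf T F) {X : C} {R : LinearSieve k X} (hR : R ∈ T.covers X)
    (s : ∀ Y : C, R.arrows Y →ₗ[k] F.obj (op Y))
    (hs : ∀ (Y Z : C) (g : Z ⟶ Y) (f : R.arrows Y),
      s Z ⟨g ≫ f.1, R.precomp_mem g f.2⟩ = res F g (s Y f)) :
    ∃ x : F.obj (op X), ∀ (Y : C) (f : R.arrows Y), res F f.1 x = s Y f := by
  obtain ⟨α, hα⟩ := (hF.bijective X R hR).2 (homMk (F := R.toFunctor) s fun _ _ g f => hs _ _ g f)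
  refine ⟨evalHom α X (𝟙 X), fun Y f => ?_⟩
  rw [← evalHom_eq]
  exact congrArg (fun α => appₗ α Y f) hα

/-- A linear presheaf with unique gluing is a sheaf. -/
lemma of_exists_unique (hF : IsLinearPresheaf F)
    (hsep : ∀ (X : C) (R : LinearSieve k X), R ∈ T.covers X → ∀ x : F.obj (op X),
      (∀ (Y : C) (f : Y ⟶ X), f ∈ R.arrows Y → res F f x = 0) → x = 0)
    (hglue : ∀ (X : C) (R : LinearSieve k X), R ∈ T.covers X → ∀ β : R.toFunctor ⟶ F,
      ∃ x : F.obj (op X), ∀ (Y : C) (f : R.arrows Y), res F f.1 x = appₗ β Y f) :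
    IsLinearSheaf T F where
  additive := ⟨fun {X Y f g} => by
    ext x
    exact hF.res_add f.unop g.unop x⟩
  map_smul r f := by
    ext x
    exact hF.res_smul r f x
  bijective X R hR := by
    constructor
    · intro α β h
      refine hom_ext_evalHom ?_
      rw [← sub_eq_zero]
      refine hsep X R hR _ fun Z g hg => ?_
      rw [map_sub, ← evalHom_eq, ← evalHom_eq, sub_eq_zero]
      exact congrArg (fun α : R.toFunctor ⟶ F => appₗ α Z ⟨g, hg⟩) h
    · intro β
      obtain ⟨x, hx⟩ := hglue X R hR β
      exact ⟨hF.yonedaHom x, hom_ext_appₗ fun Y f => hx Y f⟩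

/-- A local relation between a presheaf `N` and a sheaf `F` that is single-valued and locally
defined everywhere extends to a morphism. -/
lemma exists_hom_of_relation (hF : IsLinearSheaf T F) {N : Cᵒᵖ ⥤ ModuleCat.{v} k}
    (hN : IsLinearPresheaf N)
    (ρ : ∀ X : C, Submodule k (N.obj (op X) × F.obj (op X)))
    (hres : ∀ {X Y : C} (f : Y ⟶ X) (n : N.obj (op X)) (y : F.obj (op X)), (n, y) ∈ ρ X →
      (res N f n, res F f y) ∈ ρ Y)
    (hzero : ∀ {X : C} (y : F.obj (op X)), (0, y) ∈ ρ X → y = 0)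
    (hdom : ∀ {X : C} (n : N.obj (op X)), ∃ R ∈ T.covers X, ∀ (Y : C) (f : Y ⟶ X),
      f ∈ R.arrows Y → ∃ y, (res N f n, y) ∈ ρ Y) :
    ∃ α : N ⟶ F, ∀ (X : C) (n : N.obj (op X)) (y : F.obj (op X)), (n, y) ∈ ρ X →
      appₗ α X n = y := by
  have huniq {X : C} {n : N.obj (op X)} {y y' : F.obj (op X)} (h : (n, y) ∈ ρ X)
      (h' : (n, y') ∈ ρ X) : y = y' := by
    have := Submodule.sub_mem _ h h'
    rw [Prod.mk_sub_mk, sub_self] at this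
    exact sub_eq_zero.1 (hzero _ this)
  have hex {X : C} (n : N.obj (op X)) : ∃ x : F.obj (op X), ∀ (Y : C) (f : Y ⟶ X)
      (y : F.obj (op Y)), (res N f n, y) ∈ ρ Y → res F f x = y := by
    obtain ⟨R, hR, h⟩ := hdom n
    -- The chosen values are forced by `huniq`, hence linear and compatible with restriction, so
    -- they glue.
    choose s hs using fun (Y : C) (f : R.arrows Y) => h Y f.1 f.2
    obtain ⟨x, hx⟩ := hF.exists_res_eq hR
      (fun Y => IsLinearMap.mk' (s Y) (IsLinearMap.mk
        (fun f g => huniq (hs Y (f + g)) (by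
          rw [Submodule.coe_add, hN.res_add]
          exact Submodule.add_mem _ (hs Y f) (hs Y g)))
        (fun r f => huniq (hs Y (r • f)) (by
          rw [Submodule.coe_smul, hN.res_smul]
          exact Submodule.smul_mem _ r (hs Y f)))))
      (fun Y Z g f => huniq (hs Z ⟨g ≫ f.1, R.precomp_mem g f.2⟩) (by
        rw [res_comp]
        exact hres g _ _ (hs Y f)))
    -- Here `f` need not lie in `R`; the two sections are compared on the pullback of `R` along `f`.
    refine ⟨x, fun Y f y hy => hF.eq_of_res_eq (T.pullback_mem f hR) fun Z g hg => ?_⟩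
    rw [← res_comp]
    refine (hx Z ⟨g ≫ f, hg⟩).trans (huniq (hs Z _) ?_)
    rw [res_comp]
    exact hres g _ _ hy
  choose a ha using @hex
  have huniq' {X : C} (n : N.obj (op X)) (x : F.obj (op X)) {R : LinearSieve k X}
      (hR : R ∈ T.covers X) (h : ∀ (Y : C) (f : Y ⟶ X), f ∈ R.arrows Y →
        (res N f n, res F f x) ∈ ρ Y) : a n = x :=
    hF.eq_of_res_eq hR fun Y f hf => ha n Y f _ (h Y f hf)
  have hdom' {X : C} (n : N.obj (op X)) : ∃ R ∈ T.covers X, ∀ (Y : C) (f : Y ⟶ X),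
      f ∈ R.arrows Y → (res N f n, res F f (a n)) ∈ ρ Y := by
    obtain ⟨R, hR, h⟩ := hdom n
    refine ⟨R, hR, fun Y f hf => ?_⟩
    obtain ⟨y, hy⟩ := h Y f hf
    rwa [ha n Y f y hy]
  refine ⟨homMk (fun X => ⟨⟨a, fun n m => ?_⟩, fun r n => ?_⟩) (fun X Y f n => ?_),
    fun X n y hy => ?_⟩
  · obtain ⟨R, hR, h⟩ := hdom' n
    obtain ⟨S, hS, h'⟩ := hdom' m
    refine huniq' _ _ (T.inter_mem hR hS) fun Y f hf => ?_
    rw [map_add, map_add]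
    exact Submodule.add_mem _ (h Y f hf.1) (h' Y f hf.2)
  · obtain ⟨R, hR, h⟩ := hdom' n
    refine huniq' _ _ hR fun Y f hf => ?_
    rw [(res N f).map_smul, RingHom.id_apply, (res F f).map_smul]
    exact Submodule.smul_mem _ r (h Y f hf)
  · obtain ⟨R, hR, h⟩ := hdom' n
    refine huniq' _ _ (T.pullback_mem f hR) fun Z g hg => ?_
    simp only [LinearMap.coe_mk, AddHom.coe_mk]
    rw [← res_comp, ← res_comp]
    exact h Z _ hg
  · exact huniq' n y (T.maximal_mem X) fun Y f _ => hres f n y hy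

end IsLinearSheaf

/-- The morphisms that equalize `x` and `y` form a linear sieve because `F` is linear; containing
the generators, it contains the covering sieve. -/
lemma IsLinearSheaf.eq_of_generate {k : Type w} [CommRing k] {C : Type u} [Category.{v} C]
    [Preadditive C] [Linear k C] {T : LinearTopology k C} {F : Cᵒᵖ ⥤ ModuleCat.{v} k}
    (hF : IsLinearSheaf T F) {X : C} {ι : Type u₁} {Y : ι → C} {f : ∀ i, Y i ⟶ X}
    (hf : LinearSieve.generate k Y f ∈ T.covers X) {x y : F.obj (op X)}
    (h : ∀ i, res F (f i) x = res F (f i) y) : x = y := by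
  let E : LinearSieve k X :=
    { arrows := fun Z => LinearMap.eqLocus (hF.isLinearPresheaf.resₗ x Z)
        (hF.isLinearPresheaf.resₗ y Z)
      precomp_mem := fun {Z W e} g he => by
        have he' : res F e x = res F e y := he
        change res F (g ≫ e) x = res F (g ≫ e) y
        rw [res_comp, res_comp, he'] }
  have hE : LinearSieve.generate k Y f ≤ E := LinearSieve.generate_le_iff.2 h
  exact hF.eq_of_res_eq hf fun Z g hg => hE g hg

section RestrictedYoneda

variable {k : Type w} [CommRing k] {P : Type u} [Category.{v} P]
  {Q : Type u₁} [Category.{v} Q] [Preadditive Q] [Linear k Q]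
  {φ : P ⥤ Q}

variable (k φ) in
/-- The functor sending `Z` to the presheaf `Q(φ(-), Z)`. -/
def restrictedYoneda : Q ⥤ Pᵒᵖ ⥤ ModuleCat.{v} k :=
  linearYoneda k Q ⋙ (Functor.whiskeringLeft _ _ _).obj φ.op

/-- The components of a morphism from `Q(φ(-), Z)`. -/
def evalRestricted {F : Pᵒᵖ ⥤ ModuleCat.{v} k} {Z : Q} (α : (restrictedYoneda k φ).obj Z ⟶ F)
    (X : P) : (φ.obj X ⟶ Z) →ₗ[k] F.obj (op X) := appₗ α X

lemma evalRestricted_comp {F : Pᵒᵖ ⥤ ModuleCat.{v} k} {Z : Q}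
    (α : (restrictedYoneda k φ).obj Z ⟶ F) {X Y : P} (f : Y ⟶ X) (q : φ.obj X ⟶ Z) :
    evalRestricted α Y (φ.map f ≫ q) = res F f (evalRestricted α X q) :=
  appₗ_res α f q

lemma hom_ext_evalRestricted {F : Pᵒᵖ ⥤ ModuleCat.{v} k} {Z : Q}
    {α β : (restrictedYoneda k φ).obj Z ⟶ F}
    (h : ∀ (X : P) (q : φ.obj X ⟶ Z), evalRestricted α X q = evalRestricted β X q) : α = β :=
  hom_ext_appₗ h

end RestrictedYoneda

/-! ### Comparison lemma: restriction preserves sheaves and is fully faithful -/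

section Comparison

variable {k : Type w} [CommRing k] {P : Type u} [Category.{v} P] [Preadditive P] [Linear k P]
  {Q : Type u₁} [Category.{v} Q] [Preadditive Q] [Linear k Q]
  {T : LinearTopology k P} {T' : LinearTopology k Q} {φ : P ⥤ Q} [φ.Additive] [φ.Linear k]

lemma isLinearPresheaf_comp {H : Qᵒᵖ ⥤ ModuleCat.{v₁} k} (hH : IsLinearPresheaf H) :
    IsLinearPresheaf (φ.op ⋙ H) := by
  intro X Y r f g x
  change res H (φ.map (r • f + g)) x = r • res H (φ.map f) x + res H (φ.map g) x
  rw [φ.map_add, φ.map_smul, hH]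

namespace IsDenseMorphism

lemma eq_of_locally_eq (hφ : IsDenseMorphism T T' φ) {H : Qᵒᵖ ⥤ ModuleCat.{v} k}
    (hH : IsLinearSheaf T' H) {Z : Q} {y y' : H.obj (op Z)}
    (h : ∀ (X : P) (q : φ.obj X ⟶ Z), ∃ S ∈ T.covers X, ∀ (X' : P) (e : X' ⟶ X),
      e ∈ S.arrows X' → res H (φ.map e ≫ q) y = res H (φ.map e ≫ q) y') : y = y' := by
  refine hH.eq_of_generate (hφ.ofImage_mem Z) fun i => ?_
  obtain ⟨S, hS, hS'⟩ := h i.1 i.2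
  refine hH.eq_of_generate (hφ.map_mem hS) fun j => ?_
  rw [← res_comp, ← res_comp]
  exact hS' j.1 j.2.1 j.2.2

/-- Gluing a family of sections of a sheaf that is indexed by a presheaf on the dense site. -/
lemma exists_res_eq (hφ : IsDenseMorphism T T' φ) {H : Qᵒᵖ ⥤ ModuleCat.{v} k}
    (hH : IsLinearSheaf T' H) {Z : Q} {N : Pᵒᵖ ⥤ ModuleCat.{v} k}
    (ν : N ⟶ (restrictedYoneda k φ).obj Z) (α : N ⟶ φ.op ⋙ H)
    (n : ∀ {X : P}, N.obj (op X) → (φ.obj X ⟶ Z)) (hn : ∀ {X : P} (r : N.obj (op X)),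
      n r = appₗ ν X r)
    (hker : ∀ (X : P) (r : N.obj (op X)), n r = 0 → appₗ α X r = 0)
    (hcov : LinearSieve.generate k (fun i : Σ X : P, N.obj (op X) => φ.obj i.1)
      (fun i => n i.2) ∈ T'.covers Z) :
    ∃ y : H.obj (op Z), ∀ (X : P) (r : N.obj (op X)), res H (n r) y = appₗ α X r := by
  have hadd {X : P} (r r' : N.obj (op X)) : n (r + r') = n r + n r' := by
    rw [hn, hn, hn, map_add]; rfl
  have hsmul {X : P} (c : k) (r : N.obj (op X)) : n (c • r) = c • n r := by
    rw [hn, hn, map_smul]; rfl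
  have hzero {X : P} : n (0 : N.obj (op X)) = 0 := by rw [hn, map_zero]; rfl
  have hres {X Y : P} (f : Y ⟶ X) (r : N.obj (op X)) : n (res N f r) = φ.map f ≫ n r := by
    rw [hn, hn, appₗ_res]; rfl
  -- A pair `(q, y)` is related if, locally on each `X` with `φ.obj X ⟶ W`, the pullback of `q` is
  -- some `n r` and that of `y` is `α r`. The relation is single-valued by `hker`; no injectivity of
  -- `n` is needed.
  let ρ (W : Q) : Submodule k ((W ⟶ Z) × H.obj (op W)) :=
    { carrier := {p | ∀ (X : P) (g : φ.obj X ⟶ W), ∃ S ∈ T.covers X, ∀ (X' : P) (e : X' ⟶ X),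
        e ∈ S.arrows X' → ∃ r : N.obj (op X'), n r = φ.map e ≫ g ≫ p.1 ∧
          appₗ α X' r = res H (φ.map e ≫ g) p.2}
      add_mem' := fun {p q} hp hq X g => by
        obtain ⟨S, hS, h⟩ := hp X g
        obtain ⟨S', hS', h'⟩ := hq X g
        refine ⟨_, T.inter_mem hS hS', fun X' e he => ?_⟩
        obtain ⟨r, hr, hr'⟩ := h X' e he.1
        obtain ⟨s, hs, hs'⟩ := h' X' e he.2
        exact ⟨r + s, by rw [hadd, hr, hs]; simp, by rw [map_add, hr', hs']; simp⟩
      zero_mem' := fun X g => ⟨_, T.maximal_mem X, fun X' e _ => ⟨0, by simp [hzero], by simp⟩⟩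
      smul_mem' := fun c p hp X g => by
        obtain ⟨S, hS, h⟩ := hp X g
        refine ⟨S, hS, fun X' e he => ?_⟩
        obtain ⟨r, hr, hr'⟩ := h X' e he
        exact ⟨c • r, by rw [hsmul, hr]; simp, by rw [map_smul, hr']; simp⟩ }
  have hρ {W W' : Q} (g : W' ⟶ W) (q : W ⟶ Z) (y : H.obj (op W)) (h : (q, y) ∈ ρ W) :
      (g ≫ q, res H g y) ∈ ρ W' := by
    intro X e
    obtain ⟨S, hS, h'⟩ := h X (e ≫ g)
    refine ⟨S, hS, fun X' d hd => ?_⟩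
    obtain ⟨r, hr, hr'⟩ := h' X' d hd
    refine ⟨r, by simpa using hr, ?_⟩
    rw [← res_comp]
    simpa using hr'
  have hgen {X : P} (r : N.obj (op X)) : (n r, appₗ α X r) ∈ ρ (φ.obj X) := by
    intro Y g
    refine ⟨_, hφ.lifting_mem g, fun X' e he => ?_⟩
    obtain ⟨d, hd⟩ := LinearSieve.mem_lifting.1 he
    refine ⟨res N d r, ?_, ?_⟩
    · rw [hres, hd, Category.assoc]
    · rw [appₗ_res, ← hd]; rfl
  -- The domain of `ρ` is a sieve containing every `n r`, hence covering: `ρ` is defined locally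
  -- everywhere.
  let D : LinearSieve k Z :=
    { arrows := fun W => (ρ W).map (LinearMap.fst k _ _)
      precomp_mem := fun {W W' q} g hq => by
        obtain ⟨⟨_, y⟩, hy, rfl⟩ := hq
        exact ⟨_, hρ g _ y hy, rfl⟩ }
  have hD : D ∈ T'.covers Z :=
    T'.mem_of_le (LinearSieve.generate_le_iff.2
      fun (i : Σ X : P, N.obj (op X)) => ⟨_, hgen i.2, rfl⟩) hcov
  obtain ⟨a, ha⟩ := hH.exists_hom_of_relation (N := (linearYoneda k Q).obj Z)
    (isLinearPresheaf_linearYoneda Z) ρ hρ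
    (fun {W} y hy => hφ.eq_of_locally_eq hH fun X g => by
      obtain ⟨S, hS, h⟩ := hy X g
      refine ⟨S, hS, fun X' e he => ?_⟩
      obtain ⟨r, hr, hr'⟩ := h X' e he
      rw [map_zero]
      refine hr'.symm.trans (hker _ _ (hr.trans ?_))
      change φ.map e ≫ g ≫ (0 : W ⟶ Z) = 0
      simp)
    (fun {W} q => ⟨D.pullback q, T'.pullback_mem q hD, fun Y f hf => by
      obtain ⟨⟨q', y⟩, hy, hq⟩ := hf
      have hq' : q' = f ≫ q := hq
      subst hq'
      exact ⟨y, hy⟩⟩)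
  refine ⟨evalHom a Z (𝟙 Z), fun X r => ?_⟩
  rw [← evalHom_eq]
  exact ha _ _ _ (hgen r)

/-- Separation holds because images of covering sieves cover. For gluing, a compatible family on `R`
must descend to the image of `R` under `φ`, where distinct elements may be identified: those sent to
zero are locally zero, so separation makes the family vanish on them. -/
lemma isLinearSheaf_comp (hφ : IsDenseMorphism T T' φ) {H : Qᵒᵖ ⥤ ModuleCat.{v} k}
    (hH : IsLinearSheaf T' H) : IsLinearSheaf T (φ.op ⋙ H) := by
  have hlin := isLinearPresheaf_comp (φ := φ) hH.isLinearPresheaf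
  have hsep (X : P) (R : LinearSieve k X) (hR : R ∈ T.covers X) (x : H.obj (op (φ.obj X)))
      (h : ∀ (Y : P) (f : Y ⟶ X), f ∈ R.arrows Y → res H (φ.map f) x = 0) : x = 0 :=
    hH.eq_of_generate (hφ.map_mem hR) fun i => (h _ _ i.2.2).trans (map_zero _).symm
  refine IsLinearSheaf.of_exists_unique hlin hsep fun X R hR β => ?_
  let ν : R.toFunctor ⟶ (restrictedYoneda k φ).obj (φ.obj X) :=
    homMk (fun Y => (φ.mapLinearMap k).comp (R.arrows Y).subtype)
      fun Y Z g f => φ.map_comp g f.1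
  have hker (Y : P) (r : R.arrows Y) (hr : φ.map r.1 = 0) :
      appₗ β Y r = (0 : H.obj (op (φ.obj Y))) := by
    refine hsep _ _ (hφ.annihilator_mem r.1 hr) _ fun Z g hg => ?_
    refine (appₗ_res β g r).symm.trans ?_
    have : res R.toFunctor g r = 0 := Subtype.ext hg
    rw [this, map_zero]
  exact hφ.exists_res_eq hH ν β (fun {Y} (f : R.arrows Y) => φ.map f.1)
    (fun _ => rfl) hker (hφ.map_mem hR)

/-- The sections of `H` over `Z` represent morphisms `Q(φ(-), Z) ⟶ φ.op ⋙ H`. This is the existence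
half; uniqueness is separation along `ofImage k φ Z`. -/
lemma exists_unique_restricted (hφ : IsDenseMorphism T T' φ) {H : Qᵒᵖ ⥤ ModuleCat.{v} k}
    (hH : IsLinearSheaf T' H) {Z : Q} (α : (restrictedYoneda k φ).obj Z ⟶ φ.op ⋙ H) :
    ∃ y : H.obj (op Z), ∀ (X : P) (q : φ.obj X ⟶ Z), res H q y = evalRestricted α X q :=
  hφ.exists_res_eq hH (𝟙 _) α (fun {X} (q : φ.obj X ⟶ Z) => q) (fun _ => rfl)
    (fun X _ hq => (congrArg (evalRestricted α X) hq).trans (map_zero _)) (hφ.ofImage_mem Z)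

lemma whisker_injective (hφ : IsDenseMorphism T T' φ) {G H : Qᵒᵖ ⥤ ModuleCat.{v} k}
    (hH : IsLinearSheaf T' H) {α β : G ⟶ H}
    (h : Functor.whiskerLeft φ.op α = Functor.whiskerLeft φ.op β) : α = β := by
  refine hom_ext_appₗ fun Z x => hH.eq_of_generate (hφ.ofImage_mem Z) fun i => ?_
  rw [← appₗ_res, ← appₗ_res]
  exact congrArg (fun γ => appₗ γ i.1 (res G i.2 x)) h

/-- A section `x` of `G` over `Z` gives the family `q ↦ β (res G q x)` on the objects `φ.obj X` over
`Z`; the value of the extended morphism at `x` is its unique gluing. -/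
lemma whisker_surjective (hφ : IsDenseMorphism T T' φ) {G H : Qᵒᵖ ⥤ ModuleCat.{v} k}
    (hG : IsLinearPresheaf G) (hH : IsLinearSheaf T' H) (β : φ.op ⋙ G ⟶ φ.op ⋙ H) :
    ∃ α : G ⟶ H, Functor.whiskerLeft φ.op α = β := by
  let b (X : P) : G.obj (op (φ.obj X)) →ₗ[k] H.obj (op (φ.obj X)) := appₗ β X
  have hb {X Y : P} (f : Y ⟶ X) (x : G.obj (op (φ.obj X))) :
      b Y (res G (φ.map f) x) = res H (φ.map f) (b X x) := appₗ_res β f x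
  have hex (Z : Q) (x : G.obj (op Z)) : ∃ y : H.obj (op Z), ∀ (X : P) (q : φ.obj X ⟶ Z),
      res H q y = b X (res G q x) :=
    hφ.exists_unique_restricted hH (homMk (fun X => (b X).comp (hG.resₗ x (φ.obj X)))
      fun X Y f q => by
        refine Eq.trans ?_ (hb f _)
        exact congrArg (b Y) (res_comp G (φ.map f) q x))
  choose a ha using hex
  have hext {Z : Q} {y y' : H.obj (op Z)}
      (h : ∀ (X : P) (q : φ.obj X ⟶ Z), res H q y = res H q y') : y = y' :=
    hH.eq_of_generate (hφ.ofImage_mem Z) fun i => h i.1 i.2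
  refine ⟨homMk (fun Z => ⟨⟨a Z, fun x y => hext fun X q => ?_⟩,
    fun r x => hext fun X q => ?_⟩) fun Z W g x => hext fun X q => ?_, hom_ext_appₗ fun X x => ?_⟩
  · simp only [map_add, ha]
  · simp only [map_smul, ha, RingHom.id_apply]
  · change res H q (a _ _) = res H q (res H g (a _ _))
    rw [ha, ← res_comp, ← res_comp, ha]
  · have := ha (φ.obj X) x X (𝟙 _)
    rw [res_id, res_id] at this
    exact this

end IsDenseMorphism

end Comparison

/-! ### Comparison lemma: extension of sheaves and essential surjectivity -/

section Extension

variable {k : Type w} [CommRing k] {P : Type v} [Category.{v} P]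
  {Q : Type u₁} [Category.{v} Q] [Preadditive Q] [Linear k Q] {φ : P ⥤ Q}

variable (φ) in
/-- The extension `Z ↦ Hom(Q(φ(-), Z), F)` of a presheaf along `φ`. -/
def extension (F : Pᵒᵖ ⥤ ModuleCat.{v} k) : Qᵒᵖ ⥤ ModuleCat.{v} k :=
  (restrictedYoneda k φ).op ⋙ (linearYoneda k (Pᵒᵖ ⥤ ModuleCat.{v} k)).obj F

/-- Evaluation of the sections of an extension. -/
def evalExtension (F : Pᵒᵖ ⥤ ModuleCat.{v} k) (Z : Q) (X : P) :
    (extension φ F).obj (op Z) →ₗ[k] (φ.obj X ⟶ Z) →ₗ[k] F.obj (op X) where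
  toFun α := evalRestricted α X
  map_add' _ _ := rfl
  map_smul' _ _ := rfl

lemma evalExtension_res {F : Pᵒᵖ ⥤ ModuleCat.{v} k} {Z W : Q} (g : W ⟶ Z)
    (α : (extension φ F).obj (op Z)) {X : P} (q : φ.obj X ⟶ W) :
    evalExtension F W X (res (extension φ F) g α) q = evalExtension F Z X α (q ≫ g) := rfl

lemma evalExtension_comp {F : Pᵒᵖ ⥤ ModuleCat.{v} k} {Z : Q} (α : (extension φ F).obj (op Z))
    {X Y : P} (f : Y ⟶ X) (q : φ.obj X ⟶ Z) :
    evalExtension F Z Y α (φ.map f ≫ q) = res F f (evalExtension F Z X α q) :=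
  evalRestricted_comp _ f q

lemma evalExtension_ext {F : Pᵒᵖ ⥤ ModuleCat.{v} k} {Z : Q} {α β : (extension φ F).obj (op Z)}
    (h : ∀ (X : P) (q : φ.obj X ⟶ Z), evalExtension F Z X α q = evalExtension F Z X β q) :
    α = β :=
  hom_ext_evalRestricted (Z := Z) h

lemma isLinearPresheaf_extension (F : Pᵒᵖ ⥤ ModuleCat.{v} k) :
    IsLinearPresheaf (extension φ F) := by
  intro Z W r f g α
  refine evalExtension_ext fun X q => ?_
  rw [map_add, map_smul, LinearMap.add_apply, LinearMap.smul_apply]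
  simp only [evalExtension_res, Preadditive.comp_add, Linear.comp_smul, map_add, map_smul]

/-- The components of a morphism from a sieve. -/
def evalSieve {C : Type u} [Category.{v} C] [Preadditive C] [Linear k C] {X : C}
    {R : LinearSieve k X} {F : Cᵒᵖ ⥤ ModuleCat.{v} k} (β : R.toFunctor ⟶ F) (Y : C) :
    R.arrows Y →ₗ[k] F.obj (op Y) := appₗ β Y

lemma evalSieve_comp {C : Type u} [Category.{v} C] [Preadditive C] [Linear k C] {X : C}
    {R : LinearSieve k X} {F : Cᵒᵖ ⥤ ModuleCat.{v} k} (β : R.toFunctor ⟶ F) {Y Z : C}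
    (g : Z ⟶ Y) (r : R.arrows Y) :
    evalSieve β Z ⟨g ≫ r.1, R.precomp_mem g r.2⟩ = res F g (evalSieve β Y r) :=
  appₗ_res β g r

end Extension

section Comparison

variable {k : Type w} [CommRing k] {P : Type v} [Category.{v} P] [Preadditive P] [Linear k P]
  {Q : Type u₁} [Category.{v} Q] [Preadditive Q] [Linear k Q]
  {T : LinearTopology k P} {T' : LinearTopology k Q} {φ : P ⥤ Q} [φ.Additive] [φ.Linear k]

namespace IsDenseMorphism

/-- Only cocontinuity enters: for `R` covering `Z`, the subpresheaf `R(φ(-))` of `Q(φ(-), Z)` is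
locally everything, so morphisms from either of them to the sheaf `F` agree. -/
lemma isLinearSheaf_extension (hφ : IsDenseMorphism T T' φ) {F : Pᵒᵖ ⥤ ModuleCat.{v} k}
    (hF : IsLinearSheaf T F) : IsLinearSheaf T' (extension φ F) := by
  have hcov {Z : Q} {R : LinearSieve k Z} (hR : R ∈ T'.covers Z) {X : P} (q : φ.obj X ⟶ Z) :
      (R.pullback q).comap φ ∈ T.covers X := hφ.comap_mem (T'.pullback_mem q hR)
  refine IsLinearSheaf.of_exists_unique (isLinearPresheaf_extension F) ?_ ?_
  · intro Z R hR α h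
    refine evalExtension_ext fun X q => hF.eq_of_res_eq (hcov hR q) fun Y f hf => ?_
    have := evalExtension_res (φ.map f ≫ q) α (𝟙 _)
    rw [h _ (φ.map f ≫ q) hf, Category.id_comp, evalExtension_comp] at this
    rw [← this]
    simp
  · intro Z R hR β
    -- As in the Yoneda lemma, `β` is determined by evaluating at identities. The graph of `δ` is
    -- the relation extended below.
    let δ (X : P) : R.arrows (φ.obj X) →ₗ[k] F.obj (op X) :=
      ((evalExtension F (φ.obj X) X).flip (𝟙 _)).comp (evalSieve β (φ.obj X))
    have hβ {W : Q} (r : R.arrows W) (X : P) (q : φ.obj X ⟶ W) :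
        δ X ⟨q ≫ r.1, R.precomp_mem q r.2⟩ = evalExtension F W X (evalSieve β W r) q := by
      simp only [δ, LinearMap.comp_apply, LinearMap.flip_apply]
      rw [evalSieve_comp, evalExtension_res, Category.id_comp]
    have hδ {X Y : P} (f : Y ⟶ X) (r : R.arrows (φ.obj X)) :
        δ Y ⟨φ.map f ≫ r.1, R.precomp_mem _ r.2⟩ = res F f (δ X r) := by
      rw [hβ, ← Category.comp_id (φ.map f), evalExtension_comp]
      rfl
    obtain ⟨α, hα⟩ := hF.exists_hom_of_relation (N := (restrictedYoneda k φ).obj Z)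
      (isLinearPresheaf_comp (isLinearPresheaf_linearYoneda Z))
      (fun X => LinearMap.range ((R.arrows (φ.obj X)).subtype.prod (δ X)))
      (fun {X Y} f n y h => by
        obtain ⟨r, hr⟩ := h
        obtain ⟨rfl, rfl⟩ := Prod.mk.inj hr
        exact ⟨⟨φ.map f ≫ r.1, R.precomp_mem _ r.2⟩, Prod.ext rfl (hδ f r)⟩)
      (fun {X} y h => by
        obtain ⟨r, hr⟩ := h
        obtain ⟨h0, rfl⟩ := Prod.mk.inj hr
        have : r = 0 := Subtype.ext h0
        rw [this, map_zero])
      (fun {X} q => ⟨_, hcov hR q, fun Y f hf => ⟨δ Y ⟨φ.map f ≫ q, hf⟩,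
        ⟨⟨φ.map f ≫ q, hf⟩, rfl⟩⟩⟩)
    refine ⟨α, fun W r => evalExtension_ext fun X q => ?_⟩
    exact (hα X _ _ ⟨⟨q ≫ r.1, R.precomp_mem q r.2⟩, rfl⟩).trans (hβ r X q)

/-- The restriction of the extension of a sheaf is the original sheaf. -/
lemma nonempty_extension_iso (hφ : IsDenseMorphism T T' φ) {F : Pᵒᵖ ⥤ ModuleCat.{v} k}
    (hF : IsLinearSheaf T F) : Nonempty (φ.op ⋙ extension φ F ≅ F) := by
  let e (X : P) : ((restrictedYoneda k φ).obj (φ.obj X) ⟶ F) →ₗ[k] F.obj (op X) :=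
    { toFun := fun α => evalRestricted α X (𝟙 _)
      map_add' := fun _ _ => rfl
      map_smul' := fun _ _ => rfl }
  have he (X : P) : Function.Bijective (e X) := by
    constructor
    · intro α β h
      refine hom_ext_evalRestricted fun Y c => hF.eq_of_res_eq (hφ.lifting_mem c) fun Z f hf => ?_
      obtain ⟨g, hg⟩ := LinearSieve.mem_lifting.1 hf
      have h' : evalRestricted α X (𝟙 _) = evalRestricted β X (𝟙 _) := h
      rw [← evalRestricted_comp, ← evalRestricted_comp, ← hg, ← Category.comp_id (φ.map g),
        evalRestricted_comp, evalRestricted_comp, h']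
    · intro x
      -- The relation consists of the pairs `(φ.map r, res F r x)`. Local faithfulness makes it
      -- single-valued, local fullness makes it locally defined everywhere.
      obtain ⟨α, hα⟩ := hF.exists_hom_of_relation (N := (restrictedYoneda k φ).obj (φ.obj X))
        (isLinearPresheaf_comp (isLinearPresheaf_linearYoneda (φ.obj X)))
        (fun Y => LinearMap.range
          ((φ.mapLinearMap k (X := Y) (Y := X)).prod (hF.isLinearPresheaf.resₗ x Y)))
        (fun {Y Z} f n y h => by
          obtain ⟨r, hr⟩ := h
          obtain ⟨rfl, rfl⟩ := Prod.mk.inj hr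
          exact ⟨f ≫ r, Prod.ext (φ.map_comp f r) (res_comp F f r x)⟩)
        (fun {Y} y h => by
          obtain ⟨r, hr⟩ := h
          obtain ⟨h0, rfl⟩ := Prod.mk.inj hr
          refine hF.eq_of_res_eq (hφ.annihilator_mem r h0) fun Z g hg => ?_
          have hg' : g ≫ r = 0 := hg
          change res F g (res F r x) = res F g 0
          rw [← res_comp, hg', hF.isLinearPresheaf.res_zero, map_zero])
        (fun {Y} c => ⟨_, hφ.lifting_mem c, fun Z f hf => by
          obtain ⟨g, hg⟩ := LinearSieve.mem_lifting.1 hf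
          exact ⟨res F g x, g, Prod.ext hg rfl⟩⟩)
      refine ⟨α, hα X _ _ ⟨𝟙 X, Prod.ext (φ.map_id X) (res_id F x)⟩⟩
  refine ⟨NatIso.ofComponents
    (fun X => (LinearEquiv.ofBijective (e X.unop) (he X.unop)).toModuleIso) ?_⟩
  intro X Y f
  ext α
  let a : (restrictedYoneda k φ).obj (φ.obj X.unop) ⟶ F := α
  change evalRestricted a Y.unop (𝟙 _ ≫ φ.map f.unop) =
    res F f.unop (evalRestricted a X.unop (𝟙 _))
  rw [← evalRestricted_comp, Category.id_comp, Category.comp_id]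

/-- Restriction of sheaves along a dense morphism of sites. -/
def restriction (hφ : IsDenseMorphism T T' φ) : Sh T' ⥤ Sh T :=
  ObjectProperty.lift _
    (ObjectProperty.ι (IsLinearSheaf T') ⋙ (Functor.whiskeringLeft _ _ _).obj φ.op)
    fun H => hφ.isLinearSheaf_comp H.2

lemma isEquivalence_restriction (hφ : IsDenseMorphism T T' φ) :
    hφ.restriction.IsEquivalence where
  faithful := ⟨fun {G H α β} h => by
    ext : 1
    exact hφ.whisker_injective H.2 (congrArg (fun γ => γ.hom) h)⟩
  full := ⟨fun {G H} β => by
    obtain ⟨α, hα⟩ := hφ.whisker_surjective G.2.isLinearPresheaf H.2 β.hom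
    exact ⟨ObjectProperty.homMk α, by ext : 1; exact hα⟩⟩
  essSurj := ⟨fun F => by
    obtain ⟨e⟩ := hφ.nonempty_extension_iso F.2
    exact ⟨⟨extension φ F.1, hφ.isLinearSheaf_extension F.2⟩, ⟨ObjectProperty.isoMk _ e⟩⟩⟩

end IsDenseMorphism

lemma linearlyEquivalent_symm {k : Type w} [CommRing k] {C : Type u₁} [Category.{v₁} C]
    [Preadditive C] [Linear k C] {D : Type u₂} [Category.{v₂} D] [Preadditive D] [Linear k D]
    (h : LinearlyEquivalent k C D) : LinearlyEquivalent k D C := by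
  obtain ⟨e, he, he'⟩ := h
  exact ⟨e.symm, inferInstanceAs e.inverse.Additive, inferInstanceAs (e.inverse.Linear k)⟩

lemma linearlyEquivalent_trans {k : Type w} [CommRing k] {C : Type u₁} [Category.{v₁} C]
    [Preadditive C] [Linear k C] {D : Type u₂} [Category.{v₂} D] [Preadditive D] [Linear k D]
    {E : Type u₃} [Category.{v₃} E] [Preadditive E] [Linear k E]
    (h : LinearlyEquivalent k C D) (h' : LinearlyEquivalent k D E) :
    LinearlyEquivalent k C E := by
  obtain ⟨e, he, he'⟩ := h
  obtain ⟨f, hf, hf'⟩ := h'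
  exact ⟨e.trans f, inferInstanceAs (e.functor ⋙ f.functor).Additive,
    inferInstanceAs ((e.functor ⋙ f.functor).Linear k)⟩

/-- The comparison lemma for linear sites. -/
theorem IsDenseMorphism.linearlyEquivalent (hφ : IsDenseMorphism T T' φ) :
    LinearlyEquivalent k (Sh T') (Sh T) := by
  have := hφ.isEquivalence_restriction
  exact ⟨hφ.restriction.asEquivalence, ⟨rfl⟩, ⟨fun _ _ => rfl⟩⟩

end Comparison

/-! ### Tensor products of linear functors, sieves and topologies -/

section TensorFunctor

variable {k : Type w} [CommRing k] {A : Type u₁} [Category.{v₁} A] [Preadditive A] [Linear k A]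
  {B : Type u₂} [Category.{v₂} B] [Preadditive B] [Linear k B]
  {C : Type u₃} [Category.{v₃} C] [Preadditive C] [Linear k C]
  {D : Type u₄} [Category.{v₄} D] [Preadditive D] [Linear k D]

namespace TensorCat

lemma tmulHom_comp_tmulHom {P Q S : TensorCat k A B} (f : P.fst ⟶ Q.fst) (g : P.snd ⟶ Q.snd)
    (f' : Q.fst ⟶ S.fst) (g' : Q.snd ⟶ S.snd) :
    tmulHom f g ≫ tmulHom f' g' = tmulHom (f ≫ f') (g ≫ g') := rfl

lemma tmulHom_comp {P Q S : TensorCat k A B} (f : P.fst ⟶ Q.fst) (g : P.snd ⟶ Q.snd)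
    (t : Q ⟶ S) :
    tmulHom f g ≫ t =
      TensorProduct.map (Linear.leftComp k S.fst f) (Linear.leftComp k S.snd g) t := rfl

/-- The tensor product of two linear functors. -/
def mapFunctor (φ : A ⥤ C) [φ.Additive] [φ.Linear k] (ψ : B ⥤ D) [ψ.Additive] [ψ.Linear k] :
    TensorCat k A B ⥤ TensorCat k C D where
  obj P := ⟨φ.obj P.fst, ψ.obj P.snd⟩
  map {P Q} t := TensorProduct.map (φ.mapLinearMap k (X := P.fst) (Y := Q.fst))
    (ψ.mapLinearMap k (X := P.snd) (Y := Q.snd)) t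
  map_id P := by
    let P' : TensorCat k C D := ⟨φ.obj P.fst, ψ.obj P.snd⟩
    change (tmulHom (φ.map (𝟙 P.fst)) (ψ.map (𝟙 P.snd)) : P' ⟶ P') = 𝟙 P'
    rw [φ.map_id, ψ.map_id]
    rfl
  map_comp {P Q S} s t := by
    induction s using hom_induction with
    | add a b ha hb =>
      rw [Preadditive.add_comp]
      refine (map_add _ _ _).trans ?_
      rw [ha, hb, ← Preadditive.add_comp]
      exact congrArg (· ≫ _) (map_add _ a b).symm
    | tmul f g =>
      induction t using hom_induction with
      | add a b ha hb =>
        rw [Preadditive.comp_add]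
        refine (map_add _ _ _).trans ?_
        rw [ha, hb, ← Preadditive.comp_add]
        exact congrArg (_ ≫ ·) (map_add _ a b).symm
      | tmul f' g' =>
        let P' : TensorCat k C D := ⟨φ.obj P.fst, ψ.obj P.snd⟩
        let S' : TensorCat k C D := ⟨φ.obj S.fst, ψ.obj S.snd⟩
        change (tmulHom (φ.map (f ≫ f')) (ψ.map (g ≫ g')) : P' ⟶ S') =
          tmulHom (φ.map f ≫ φ.map f') (ψ.map g ≫ ψ.map g')
        rw [φ.map_comp, ψ.map_comp]

variable (φ : A ⥤ C) [φ.Additive] [φ.Linear k] (ψ : B ⥤ D) [ψ.Additive] [ψ.Linear k]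

instance : (mapFunctor (k := k) φ ψ).Additive where
  map_add {_ _ a b} := map_add (TensorProduct.map (φ.mapLinearMap k) (ψ.mapLinearMap k)) a b

instance : (mapFunctor (k := k) φ ψ).Linear k where
  map_smul a r := map_smul (TensorProduct.map (φ.mapLinearMap k) (ψ.mapLinearMap k)) r a

lemma mapFunctor_map_tmulHom {P Q : TensorCat k A B} (f : P.fst ⟶ Q.fst) (g : P.snd ⟶ Q.snd) :
    (mapFunctor φ ψ).map (tmulHom f g) = tmulHom (φ.map f) (ψ.map g) := rfl

end TensorCat

open TensorCat

namespace LinearSieve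

lemma tmulHom_mem_tensor {P Q : TensorCat k A B} {R : LinearSieve k Q.fst}
    {S : LinearSieve k Q.snd} {f : P.fst ⟶ Q.fst} {g : P.snd ⟶ Q.snd} (hf : f ∈ R.arrows _)
    (hg : g ∈ S.arrows _) : (tmulHom f g : P ⟶ Q) ∈ (R.tensor S).arrows P :=
  ⟨⟨f, hf⟩ ⊗ₜ ⟨g, hg⟩, rfl⟩

lemma tensor_le_iff {Q : TensorCat k A B} {R : LinearSieve k Q.fst}
    {S : LinearSieve k Q.snd} {U : LinearSieve k Q} :
    R.tensor S ≤ U ↔ ∀ (P : TensorCat k A B) (f : P.fst ⟶ Q.fst) (g : P.snd ⟶ Q.snd),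
      f ∈ R.arrows _ → g ∈ S.arrows _ → (tmulHom f g : P ⟶ Q) ∈ U.arrows P := by
  refine ⟨fun h P f g hf hg => h _ (tmulHom_mem_tensor hf hg), fun h P t ht => ?_⟩
  obtain ⟨t, rfl⟩ := ht
  induction t using TensorProduct.induction_on with
  | zero => exact (map_zero (TensorProduct.map (R.arrows P.fst).subtype
      (S.arrows P.snd).subtype)).symm ▸ Submodule.zero_mem _
  | add a b ha hb => exact (map_add (TensorProduct.map (R.arrows P.fst).subtype
      (S.arrows P.snd).subtype) a b).symm ▸ Submodule.add_mem _ ha hb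
  | tmul a b => exact h P a.1 b.1 a.2 b.2

lemma generate_tensor_generate_le {Q : TensorCat k A B} {ι ι' : Type*} {Y : ι → A}
    {f : ∀ i, Y i ⟶ Q.fst} {Y' : ι' → B} {g : ∀ i, Y' i ⟶ Q.snd} {U : LinearSieve k Q}
    (h : ∀ i j, (tmulHom (f i) (g j) : (⟨Y i, Y' j⟩ : TensorCat k A B) ⟶ Q) ∈ U.arrows _) :
    (generate k Y f).tensor (generate k Y' g) ≤ U := by
  refine tensor_le_iff.2 fun P a b ha hb => ?_
  let m : (P.fst ⟶ Q.fst) →ₗ[k] (P.snd ⟶ Q.snd) →ₗ[k] (P ⟶ Q) :=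
    TensorProduct.mk k (P.fst ⟶ Q.fst) (P.snd ⟶ Q.snd)
  change m a b ∈ U.arrows P
  induction ha using Submodule.span_induction with
  | zero => rw [map_zero]; exact Submodule.zero_mem _
  | add x y _ _ hx hy => rw [map_add]; exact Submodule.add_mem _ hx hy
  | smul r x _ hx => rw [map_smul]; exact Submodule.smul_mem _ r hx
  | mem x hx =>
    obtain ⟨i, c, rfl⟩ := hx
    induction hb using Submodule.span_induction with
    | zero => rw [map_zero]; exact Submodule.zero_mem _
    | add x y _ _ hx hy => rw [map_add]; exact Submodule.add_mem _ hx hy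
    | smul r x _ hx => rw [map_smul]; exact Submodule.smul_mem _ r hx
    | mem x hx =>
      obtain ⟨j, d, rfl⟩ := hx
      exact U.precomp_mem (tmulHom c d : P ⟶ ⟨Y i, Y' j⟩) (h i j)

end LinearSieve

namespace LinearTopology

variable (TA : LinearTopology k A) (TB : LinearTopology k B)

/-- Glue along `R ⊠ B(-, Y)`: the pullback of `R ⊠ S` along `f ⊗ g` with `f` in `R` contains the
generator `A(-, X') ⊠ g⁻¹S`. -/
lemma tensor_mem {Q : TensorCat k A B} {R : LinearSieve k Q.fst} {S : LinearSieve k Q.snd}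
    (hR : R ∈ TA.covers Q.fst) (hS : S ∈ TB.covers Q.snd) :
    R.tensor S ∈ (TA.tensor TB).covers Q := by
  have h : R.tensor (LinearSieve.maximal k Q.snd) ∈ (TA.tensor TB).covers Q :=
    fun _ hT => hT Q (Or.inl ⟨R, hR, rfl⟩)
  refine mem_of_le_closure _ h (LinearSieve.tensor_le_iff.2 fun P f g hf _ => ?_)
  have h' : (LinearSieve.maximal k P.fst).tensor (S.pullback g) ∈ (TA.tensor TB).covers P :=
    fun _ hT => hT P (Or.inr ⟨_, TB.pullback_mem g hS, rfl⟩)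
  refine mem_of_le _ (LinearSieve.tensor_le_iff.2 fun P' f' g' _ hg' => ?_) h'
  exact LinearSieve.tmulHom_mem_tensor (R.precomp_mem f' hf) hg'

variable {TA TB}

/-- For a pure tensor take the two pullbacks; for a sum, intersect the sieves found for the
summands. This reduces statements about pullbacks of generating covers to sieves of the form `R' ⊠
S'`. -/
lemma exists_tensor_le_pullback {P Q : TensorCat k A B} {R : LinearSieve k Q.fst}
    {S : LinearSieve k Q.snd} (hR : R ∈ TA.covers Q.fst) (hS : S ∈ TB.covers Q.snd) (t : P ⟶ Q) :
    ∃ R' ∈ TA.covers P.fst, ∃ S' ∈ TB.covers P.snd, R'.tensor S' ≤ (R.tensor S).pullback t := by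
  induction t using hom_induction with
  | tmul f g =>
    refine ⟨_, TA.pullback_mem f hR, _, TB.pullback_mem g hS,
      LinearSieve.tensor_le_iff.2 fun P' f' g' hf' hg' => ?_⟩
    exact LinearSieve.tmulHom_mem_tensor hf' hg'
  | add a b ha hb =>
    obtain ⟨R₁, hR₁, S₁, hS₁, h₁⟩ := ha
    obtain ⟨R₂, hR₂, S₂, hS₂, h₂⟩ := hb
    refine ⟨_, TA.inter_mem hR₁ hR₂, _, TB.inter_mem hS₁ hS₂,
      LinearSieve.tensor_le_iff.2 fun P' f' g' hf' hg' => ?_⟩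
    rw [LinearSieve.mem_pullback, Preadditive.comp_add]
    exact Submodule.add_mem _ (h₁ _ (LinearSieve.tmulHom_mem_tensor hf'.1 hg'.1))
      (h₂ _ (LinearSieve.tmulHom_mem_tensor hf'.2 hg'.2))

lemma tensorCovers_exists {Q : TensorCat k A B} {U : LinearSieve k Q}
    (hU : U ∈ tensorCovers TA TB Q) : ∃ R ∈ TA.covers Q.fst, ∃ S ∈ TB.covers Q.snd,
      U = R.tensor S := by
  rcases hU with ⟨R, hR, rfl⟩ | ⟨S, hS, rfl⟩
  · exact ⟨R, hR, _, TB.maximal_mem _, rfl⟩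
  · exact ⟨_, TA.maximal_mem _, S, hS, rfl⟩

end LinearTopology

/-! ### Local faithfulness after tensoring morphism spaces with a module -/

section Annihilator

variable {N : Type u} [AddCommGroup N] [Module k N]

/-- The sieve of all morphisms that annihilate an element of `A(X, Y) ⊗ N`. -/
def LinearSieve.tensorAnnihilator {X Y : A} (t : (X ⟶ Y) ⊗[k] N) : LinearSieve k X where
  arrows W := LinearMap.ker (((LinearMap.rTensorHom N).comp (Linear.comp (S := k) W X Y)).flip t)
  precomp_mem {W W' f} g hf := by
    have hf' : (Linear.leftComp k Y f).rTensor N t = 0 := hf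
    change (Linear.leftComp k Y (g ≫ f)).rTensor N t = 0
    have : Linear.leftComp k Y (g ≫ f) = (Linear.leftComp k Y g).comp (Linear.leftComp k Y f) := by
      ext h
      simp
    rw [this, LinearMap.rTensor_comp_apply, hf', map_zero]

lemma LinearSieve.mem_tensorAnnihilator {X Y W : A} {t : (X ⟶ Y) ⊗[k] N} {f : W ⟶ X} :
    f ∈ (LinearSieve.tensorAnnihilator t).arrows W ↔
      (Linear.leftComp k Y f).rTensor N t = 0 := Iff.rfl

variable {T : LinearTopology k A} {φ : A ⥤ C} [φ.Additive] [φ.Linear k]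

lemma rTensor_map_leftComp {X Y W : A} (f : W ⟶ X) (t : (X ⟶ Y) ⊗[k] N) :
    (φ.mapLinearMap k).rTensor N ((Linear.leftComp k Y f).rTensor N t) =
      (Linear.leftComp k (φ.obj Y) (φ.map f)).rTensor N ((φ.mapLinearMap k).rTensor N t) := by
  rw [← LinearMap.rTensor_comp_apply, ← LinearMap.rTensor_comp_apply]
  congr 2
  ext g
  simp

/-- By flatness the kernel of `φ ⊗ N` is the image of `ker φ ⊗ N`, so `t` is a finite sum of `a ⊗ n`
with `φ a = 0`; intersect the annihilators of the `a`. -/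
lemma tensorAnnihilator_mem_of_flat [Module.Flat k N]
    (hann : ∀ {X Y : A} (a : X ⟶ Y), φ.map a = 0 → LinearSieve.annihilator k a ∈ T.covers X)
    {X Y : A} (t : (X ⟶ Y) ⊗[k] N) (ht : (φ.mapLinearMap k).rTensor N t = 0) :
    LinearSieve.tensorAnnihilator t ∈ T.covers X := by
  have hexact := Module.Flat.rTensor_exact N
    (LinearMap.exact_subtype_ker_map (φ.mapLinearMap k (X := X) (Y := Y)))
  obtain ⟨s, rfl⟩ := (hexact t).1 ht
  clear ht
  induction s using TensorProduct.induction_on with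
  | zero => exact T.of_id_mem (by simp [LinearSieve.mem_tensorAnnihilator])
  | tmul a n =>
    refine T.mem_of_le (fun W f hf => ?_) (hann a.1 a.2)
    have hf' : f ≫ a.1 = 0 := hf
    simp [LinearSieve.mem_tensorAnnihilator, hf']
  | add a b ha hb =>
    refine T.mem_of_le (fun W f hf => ?_) (T.inter_mem ha hb)
    have h₁ := LinearSieve.mem_tensorAnnihilator.1 hf.1
    have h₂ := LinearSieve.mem_tensorAnnihilator.1 hf.2
    rw [LinearSieve.mem_tensorAnnihilator, map_add, map_add, h₁, h₂, add_zero]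

lemma exists_rTensor_lift
    (hlift : ∀ {X Y : A} (c : φ.obj X ⟶ φ.obj Y), LinearSieve.lifting k φ c ∈ T.covers X)
    {X Y : A} (z : (φ.obj X ⟶ φ.obj Y) ⊗[k] N) :
    ∃ S ∈ T.covers X, ∀ (W : A) (f : W ⟶ X), f ∈ S.arrows W → ∃ z' : (W ⟶ Y) ⊗[k] N,
      (φ.mapLinearMap k).rTensor N z' = (Linear.leftComp k (φ.obj Y) (φ.map f)).rTensor N z := by
  induction z using TensorProduct.induction_on with
  | zero => exact ⟨_, T.maximal_mem X, fun W f _ => ⟨0, by simp⟩⟩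
  | tmul c n =>
    refine ⟨_, hlift c, fun W f hf => ?_⟩
    obtain ⟨e, he⟩ := LinearSieve.mem_lifting.1 hf
    exact ⟨e ⊗ₜ n, by simp [he]⟩
  | add a b ha hb =>
    obtain ⟨S₁, hS₁, h₁⟩ := ha
    obtain ⟨S₂, hS₂, h₂⟩ := hb
    refine ⟨_, T.inter_mem hS₁ hS₂, fun W f hf => ?_⟩
    obtain ⟨z₁, hz₁⟩ := h₁ W f hf.1
    obtain ⟨z₂, hz₂⟩ := h₂ W f hf.2
    exact ⟨z₁ + z₂, by rw [map_add, map_add, hz₁, hz₂]⟩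

lemma rTensor_lTensor_comm {M M' N N' : Type*} [AddCommGroup M] [Module k M] [AddCommGroup M']
    [Module k M'] [AddCommGroup N] [Module k N] [AddCommGroup N'] [Module k N'] (f : M →ₗ[k] M')
    (g : N →ₗ[k] N') (t : M ⊗[k] N) :
    f.rTensor N' (g.lTensor M t) = g.lTensor M' (f.rTensor N t) := by
  rw [← LinearMap.comp_apply, ← LinearMap.comp_apply, LinearMap.rTensor_comp_lTensor,
    LinearMap.lTensor_comp_rTensor]

/-- Lift `t` to `s` over the flat module `F`. By right exactness `φ(s)` comes from some `z` over
`ker π`. Local fullness lifts `z` locally to `z'`; subtracting it from `s` changes nothing over `N`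
and reduces to the flat case. -/
lemma tensorAnnihilator_mem_of_surjective {F : Type*} [AddCommGroup F] [Module k F]
    [Module.Flat k F] (π : F →ₗ[k] N) (hπ : Function.Surjective π)
    (hlift : ∀ {X Y : A} (c : φ.obj X ⟶ φ.obj Y), LinearSieve.lifting k φ c ∈ T.covers X)
    (hann : ∀ {X Y : A} (a : X ⟶ Y), φ.map a = 0 → LinearSieve.annihilator k a ∈ T.covers X)
    {X Y : A} (t : (X ⟶ Y) ⊗[k] N) (ht : (φ.mapLinearMap k).rTensor N t = 0) :
    LinearSieve.tensorAnnihilator t ∈ T.covers X := by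
  obtain ⟨s, rfl⟩ := LinearMap.lTensor_surjective (X ⟶ Y) hπ t
  have hker : Function.Exact (LinearMap.ker π).subtype π := LinearMap.exact_subtype_ker_map π
  have hexact := lTensor_exact (φ.obj X ⟶ φ.obj Y) (f := (LinearMap.ker π).subtype) hker hπ
  rw [rTensor_lTensor_comm] at ht
  obtain ⟨z, hz⟩ := (hexact _).1 ht
  obtain ⟨S, hS, h⟩ := exists_rTensor_lift (T := T) hlift z
  refine T.glue_mem _ hS fun W f hf => ?_
  obtain ⟨z', hz'⟩ := h W f hf
  have key := tensorAnnihilator_mem_of_flat (T := T) (φ := φ) hann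
    ((Linear.leftComp k Y f).rTensor _ s - (LinearMap.ker π).subtype.lTensor _ z') (by
      rw [map_sub, rTensor_map_leftComp, rTensor_lTensor_comm, hz', ← rTensor_lTensor_comm, hz,
        sub_self])
  refine T.mem_of_le (fun V g hg => ?_) key
  rw [LinearSieve.mem_tensorAnnihilator, map_sub, sub_eq_zero] at hg
  have hcomp : Linear.leftComp k Y (g ≫ f) =
      (Linear.leftComp k Y g).comp (Linear.leftComp k Y f) := by
    ext h
    simp
  -- Along `g ≫ f`, the lift `s` agrees with a restriction of `z'`, which `π` kills.
  rw [LinearSieve.mem_pullback, LinearSieve.mem_tensorAnnihilator, rTensor_lTensor_comm, hcomp,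
    LinearMap.rTensor_comp_apply, hg, rTensor_lTensor_comm, ← LinearMap.lTensor_comp_apply,
    LinearMap.comp_ker_subtype, LinearMap.lTensor_zero, LinearMap.zero_apply]

/-- A locally full and locally faithful functor remains locally faithful after tensoring the
morphism spaces with any module. -/
lemma tensorAnnihilator_mem
    (hlift : ∀ {X Y : A} (c : φ.obj X ⟶ φ.obj Y), LinearSieve.lifting k φ c ∈ T.covers X)
    (hann : ∀ {X Y : A} (a : X ⟶ Y), φ.map a = 0 → LinearSieve.annihilator k a ∈ T.covers X)
    {X Y : A} (t : (X ⟶ Y) ⊗[k] N) (ht : (φ.mapLinearMap k).rTensor N t = 0) :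
    LinearSieve.tensorAnnihilator t ∈ T.covers X :=
  tensorAnnihilator_mem_of_surjective (Finsupp.linearCombination k id)
    (Finsupp.linearCombination_id_surjective k N) hlift hann t ht

end Annihilator

/-! ### Stability of dense morphisms under tensor products -/

variable {TA : LinearTopology k A} {TB : LinearTopology k B} {TC : LinearTopology k C}
  {TD : LinearTopology k D} {φ : A ⥤ C} [φ.Additive] [φ.Linear k] {ψ : B ⥤ D} [ψ.Additive]
  [ψ.Linear k]

/-- Factor `φ ⊗ ψ` as `(1 ⊗ ψ) ∘ (φ ⊗ 1)` and apply `tensorAnnihilator_mem` twice: local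
faithfulness of `ψ` makes `(φ ⊗ 1)(t)` vanish locally in the second variable, then that of `φ` makes
`t` vanish locally in the first. -/
lemma IsDenseMorphism.annihilator_mapFunctor_mem (hφ : IsDenseMorphism TA TC φ)
    (hψ : IsDenseMorphism TB TD ψ) {P Q : TensorCat k A B} (t : P ⟶ Q)
    (ht : (mapFunctor φ ψ).map t = 0) :
    LinearSieve.annihilator k t ∈ (TA.tensor TB).covers P := by
  let t₀ : (P.fst ⟶ Q.fst) ⊗[k] (P.snd ⟶ Q.snd) := t
  have ht₀ : (ψ.mapLinearMap k).lTensor (φ.obj P.fst ⟶ φ.obj Q.fst)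
      ((φ.mapLinearMap k).rTensor (P.snd ⟶ Q.snd) t₀) = 0 := by
    rw [← LinearMap.comp_apply, LinearMap.lTensor_comp_rTensor]
    exact ht
  let t₁ := TensorProduct.comm k _ _ ((φ.mapLinearMap k).rTensor (P.snd ⟶ Q.snd) t₀)
  have ht₁ : (ψ.mapLinearMap k).rTensor (φ.obj P.fst ⟶ φ.obj Q.fst) t₁ = 0 := by
    rw [LinearMap.rTensor_comm, ht₀, map_zero]
  have hS := tensorAnnihilator_mem (T := TB) hψ.lifting_mem hψ.annihilator_mem t₁ ht₁
  refine LinearTopology.mem_of_le_closure _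
    (LinearTopology.tensor_mem TA TB (TA.maximal_mem P.fst) hS)
    (LinearSieve.tensor_le_iff.2 fun W f g _ hg => ?_)
  let W' : TensorCat k A B := ⟨P.fst, W.snd⟩
  let g' : W' ⟶ P := tmulHom (𝟙 P.fst) g
  -- As `f ⊗ g` factors through `1 ⊗ g` and the closure is a sieve, only `1 ⊗ g` matters.
  suffices h : g' ∈ ((TA.tensor TB).closure (LinearSieve.annihilator k t)).arrows W' by
    have h' := LinearSieve.precomp_mem _ (tmulHom f (𝟙 W.snd) : W ⟶ W') h
    rwa [tmulHom_comp_tmulHom, Category.comp_id, Category.id_comp] at h'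
  let t₂ := (Linear.leftComp k Q.snd g).lTensor (P.fst ⟶ Q.fst) t₀
  have ht₂ : (φ.mapLinearMap k).rTensor _ t₂ = 0 := by
    have := LinearSieve.mem_tensorAnnihilator.1 hg
    rw [LinearMap.rTensor_comm, LinearEquiv.map_eq_zero_iff] at this
    rw [rTensor_lTensor_comm, this]
  have hR := tensorAnnihilator_mem (T := TA) hφ.lifting_mem hφ.annihilator_mem t₂ ht₂
  rw [LinearTopology.mem_closure]
  have hU := LinearTopology.tensor_mem (Q := W') TA TB hR (TB.maximal_mem W.snd)
  refine LinearTopology.mem_of_le _ (LinearSieve.tensor_le_iff.2 fun V a b ha _ => ?_) hU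
  have hg' : g' ≫ t = t₂ := by
    rw [tmulHom_comp]
    change TensorProduct.map (Linear.leftComp k Q.fst (𝟙 P.fst)) _ t₀ = _
    have : Linear.leftComp k Q.fst (𝟙 P.fst) = LinearMap.id := by
      ext h
      simp
    rw [this]
    rfl
  have hab : tmulHom a b ≫ (t₂ : W' ⟶ Q) = 0 := by
    rw [tmulHom_comp]
    have ha' := LinearSieve.mem_tensorAnnihilator.1 ha
    refine (DFunLike.congr_fun (LinearMap.lTensor_comp_rTensor _ _ _).symm t₂).trans ?_
    rw [LinearMap.comp_apply, ha', map_zero]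
  change (tmulHom a b ≫ g') ≫ t = 0
  rw [Category.assoc, hg', hab]

lemma LinearSieve.map_tensor_map_le {Q : TensorCat k A B} (R : LinearSieve k Q.fst)
    (S : LinearSieve k Q.snd) :
    (R.map φ).tensor (S.map ψ) ≤ (R.tensor S).map (mapFunctor φ ψ) :=
  generate_tensor_generate_le (Q := (mapFunctor φ ψ).obj Q) fun i j =>
    map_mem (mapFunctor φ ψ) (R := R.tensor S)
      (tmulHom_mem_tensor (P := ⟨i.1, j.1⟩) i.2.2 j.2.2)

lemma LinearSieve.ofImage_tensor_ofImage_le (Z : TensorCat k C D) :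
    (ofImage k φ Z.fst).tensor (ofImage k ψ Z.snd) ≤ ofImage k (mapFunctor φ ψ) Z :=
  generate_tensor_generate_le (Q := Z) fun i j =>
    mem_generate (k := k)
      (fun i : Σ X : TensorCat k A B, ((mapFunctor φ ψ).obj X ⟶ Z) => (mapFunctor φ ψ).obj i.1)
      (fun i => i.2) ⟨⟨i.1, j.1⟩, tmulHom i.2 j.2⟩

lemma LinearSieve.map_mono (φ : A ⥤ C) {X : A} {R S : LinearSieve k X} (h : R ≤ S) :
    R.map φ ≤ S.map φ :=
  generate_le_iff.2 fun i => map_mem φ (h _ i.2.2)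

theorem IsDenseMorphism.tensor (hφ : IsDenseMorphism TA TC φ) (hψ : IsDenseMorphism TB TD ψ) :
    IsDenseMorphism (TA.tensor TB) (TC.tensor TD) (mapFunctor φ ψ) where
  lifting_mem {P Q} c := by
    induction c using hom_induction with
    | add a b ha hb =>
      refine LinearTopology.mem_of_le _ (fun W e he => ?_) (LinearTopology.inter_mem _ ha hb)
      obtain ⟨x, hx⟩ := LinearSieve.mem_lifting.1 he.1
      obtain ⟨y, hy⟩ := LinearSieve.mem_lifting.1 he.2
      exact LinearSieve.mem_lifting.2 ⟨x + y, by
        rw [Functor.map_add, hx, hy, Preadditive.comp_add]⟩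
    | tmul f g =>
      refine LinearTopology.mem_of_le _ (LinearSieve.tensor_le_iff.2 fun W a b ha hb => ?_)
        (LinearTopology.tensor_mem TA TB (hφ.lifting_mem f) (hψ.lifting_mem g))
      obtain ⟨x, hx⟩ := LinearSieve.mem_lifting.1 ha
      obtain ⟨y, hy⟩ := LinearSieve.mem_lifting.1 hb
      refine LinearSieve.mem_lifting.2 ⟨tmulHom x y, ?_⟩
      rw [mapFunctor_map_tmulHom, mapFunctor_map_tmulHom, hx, hy]
      rfl
  annihilator_mem t ht := hφ.annihilator_mapFunctor_mem hψ t ht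
  ofImage_mem Z := LinearTopology.mem_of_le _ (LinearSieve.ofImage_tensor_ofImage_le Z)
    (LinearTopology.tensor_mem TC TD (hφ.ofImage_mem Z.fst) (hψ.ofImage_mem Z.snd))
  comap_mem {P R} hR := by
    -- By minimality of the tensor topology, it suffices that the pushforward topology contains its
    -- generators. The argument for `map_mem` is the same, with the topology `continuity`.
    have h : R ∈ ((TA.tensor TB).pushforward (mapFunctor φ ψ)).covers _ := by
      refine hR _ fun Z U hU X g => ?_
      obtain ⟨R₁, hR₁, R₂, hR₂, rfl⟩ := LinearTopology.tensorCovers_exists hU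
      obtain ⟨S₁, hS₁, S₂, hS₂, hS⟩ := LinearTopology.exists_tensor_le_pullback hR₁ hR₂ g
      refine LinearTopology.mem_of_le _ (LinearSieve.tensor_le_iff.2 fun W a b ha hb => ?_)
        (LinearTopology.tensor_mem TA TB (hφ.comap_mem hS₁) (hψ.comap_mem hS₂))
      exact hS _ (LinearSieve.tmulHom_mem_tensor ha hb)
    have := h P (𝟙 _)
    rwa [LinearSieve.pullback_id] at this
  map_mem {P R} hR := by
    have h : R ∈ ((TC.tensor TD).continuity (mapFunctor φ ψ)).covers _ := by
      refine hR _ fun X U hU Y f => ?_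
      obtain ⟨R₁, hR₁, R₂, hR₂, rfl⟩ := LinearTopology.tensorCovers_exists hU
      obtain ⟨S₁, hS₁, S₂, hS₂, hS⟩ := LinearTopology.exists_tensor_le_pullback hR₁ hR₂ f
      refine LinearTopology.mem_of_le _ (LinearSieve.map_mono _ hS) ?_
      exact LinearTopology.mem_of_le _ (LinearSieve.map_tensor_map_le S₁ S₂)
        (LinearTopology.tensor_mem (Q := (mapFunctor φ ψ).obj Y) TC TD (hφ.map_mem hS₁)
          (hψ.map_mem hS₂))
    have := h P (𝟙 _)
    rwa [LinearSieve.pullback_id] at this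

end TensorFunctor

/-! ### Recognition of dense morphisms and induced topologies -/

section DenseMorphisms

variable {k : Type w} [CommRing k] {P : Type u} [Category.{v} P] [Preadditive P] [Linear k P]
  {Q : Type u₁} [Category.{v₁} Q] [Preadditive Q] [Linear k Q] {T' : LinearTopology k Q}
  {φ : P ⥤ Q} [φ.Additive] [φ.Linear k]

/-- For `r : W ⟶ φ.obj X` in `R`, density covers `W` by morphisms `q` from the image of `φ`; each `q
≫ r` is locally some `φ.map e`, and such an `e` lies in `R.comap φ`. -/
lemma map_comap_mem
    (hlift : ∀ {X Y : P} (c : φ.obj X ⟶ φ.obj Y),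
      (LinearSieve.lifting k φ c).map φ ∈ T'.covers (φ.obj X))
    (himage : ∀ Z : Q, LinearSieve.ofImage k φ Z ∈ T'.covers Z)
    {X : P} {R : LinearSieve k (φ.obj X)} (hR : R ∈ T'.covers (φ.obj X)) :
    (R.comap φ).map φ ∈ T'.covers (φ.obj X) := by
  refine T'.glue_mem _ hR fun W r hr => T'.mem_of_le_closure (himage W)
    (LinearSieve.ofImage_le_iff.2 fun Y q => ?_)
  rw [LinearTopology.mem_closure, ← LinearSieve.pullback_comp]
  refine T'.mem_of_le (LinearSieve.map_le_iff.2 fun Z h hh => ?_) (hlift (q ≫ r))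
  obtain ⟨e, he⟩ := LinearSieve.mem_lifting.1 hh
  change φ.map h ≫ q ≫ r ∈ ((R.comap φ).map φ).arrows _
  rw [← he]
  refine LinearSieve.map_mem φ ?_
  change φ.map e ∈ R.arrows _
  rw [he]
  exact R.precomp_mem _ (R.precomp_mem _ hr)

lemma IsDenseMorphism.of_covers_iff {T : LinearTopology k P}
    (hlift : ∀ {X Y : P} (c : φ.obj X ⟶ φ.obj Y), LinearSieve.lifting k φ c ∈ T.covers X)
    (hann : ∀ {X Y : P} (a : X ⟶ Y), φ.map a = 0 → LinearSieve.annihilator k a ∈ T.covers X)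
    (himage : ∀ Z : Q, LinearSieve.ofImage k φ Z ∈ T'.covers Z)
    (hcov : ∀ (X : P) (R : LinearSieve k X), R ∈ T.covers X ↔ R.map φ ∈ T'.covers (φ.obj X)) :
    IsDenseMorphism T T' φ where
  lifting_mem := hlift
  annihilator_mem := hann
  ofImage_mem := himage
  comap_mem hR := (hcov _ _).2 (map_comap_mem (fun c => (hcov _ _).1 (hlift c)) himage hR)
  map_mem hR := (hcov _ _).1 hR

lemma LinearSieve.comap_map_le [φ.Full] [φ.Faithful] {X : P} (R : LinearSieve k X) :
    (R.map φ).comap φ ≤ R := by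
  have key (Y : P) : (R.map φ).arrows (φ.obj Y) ≤
      (R.arrows Y).map (φ.mapLinearMap k (X := Y) (Y := X)) := by
    change Submodule.span k _ ≤ _
    rw [Submodule.span_le]
    rintro _ ⟨i, c, rfl⟩
    obtain ⟨c, rfl⟩ := φ.map_surjective c
    exact ⟨c ≫ i.2.1, R.precomp_mem c i.2.2, φ.map_comp _ _⟩
  intro Y f hf
  obtain ⟨g, hg, hgf⟩ := key Y hf
  exact φ.map_injective hgf ▸ hg

/-- The topology induced on a dense full subcategory of a linear site. -/
def LinearTopology.induced (T' : LinearTopology k Q) (φ : P ⥤ Q) [φ.Additive] [φ.Linear k]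
    [φ.Full] [φ.Faithful] (himage : ∀ Z : Q, LinearSieve.ofImage k φ Z ∈ T'.covers Z) :
    LinearTopology k P where
  covers X := {R | R.map φ ∈ T'.covers (φ.obj X)}
  maximal_mem X := T'.of_id_mem (by
    rw [← φ.map_id]
    exact LinearSieve.map_mem φ Submodule.mem_top)
  pullback_mem {X Y R} f hR := by
    have h := map_comap_mem (T' := T') (φ := φ) (fun {X Y} c => T'.of_id_mem (by
      rw [← φ.map_id]
      refine LinearSieve.map_mem φ (LinearSieve.mem_lifting.2 ⟨φ.preimage c, ?_⟩)
      simp)) himage (T'.pullback_mem (φ.map f) hR)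
    refine T'.mem_of_le (LinearSieve.map_mono φ fun Z g hg => ?_) h
    refine R.comap_map_le (φ := φ) _ ?_
    change φ.map (g ≫ f) ∈ (R.map φ).arrows _
    rw [φ.map_comp]
    exact hg
  glue_mem {X R} S hR hS := by
    refine T'.mem_of_le_closure hR (LinearSieve.map_le_iff.2 fun Y f hf => ?_)
    refine T'.mem_of_le (LinearSieve.map_le_iff.2 fun Z g hg => ?_) (hS Y f hf)
    change φ.map g ≫ φ.map f ∈ (S.map φ).arrows _
    rw [← φ.map_comp]
    exact LinearSieve.map_mem φ hg

end DenseMorphisms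

/-! ### Jointly epimorphic sieves -/

section JointlyEpi

variable {k : Type w} [CommRing k] {C : Type u} [Category.{v} C] [Preadditive C] [Linear k C]

lemma generate_mem_jointlyEpiCovers {X : C} {ι : Type u₁} {Y : ι → C} {f : ∀ i, Y i ⟶ X} :
    LinearSieve.generate k Y f ∈ jointlyEpiCovers k C X ↔
      ∀ (Z : C) (g h : X ⟶ Z), (∀ i, f i ≫ g = f i ≫ h) → g = h := by
  refine ⟨fun H Z g h hgh => H Z g h fun W e he => ?_,
    fun H Z g h hgh => H Z g h fun i => hgh _ _ (LinearSieve.mem_generate Y f i)⟩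
  have key : LinearSieve.generate k Y f ≤ LinearSieve.annihilator k (g - h) :=
    LinearSieve.generate_le_iff.2 fun i => by
      change f i ≫ (g - h) = 0
      rw [Preadditive.comp_sub, hgh, sub_self]
  have he' : e ≫ (g - h) = 0 := key _ he
  rwa [Preadditive.comp_sub, sub_eq_zero] at he'

lemma generate_map_mem_jointlyEpiCovers {D : Type u₂} [Category.{v₂} D] [Preadditive D]
    [Linear k D] (e : C ⥤ D) [e.IsEquivalence] {X : C} {ι : Type u₁} {Y : ι → C}
    {f : ∀ i, Y i ⟶ X} :
    LinearSieve.generate k (fun i => e.obj (Y i)) (fun i => e.map (f i)) ∈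
      jointlyEpiCovers k D (e.obj X) ↔ LinearSieve.generate k Y f ∈ jointlyEpiCovers k C X := by
  rw [generate_mem_jointlyEpiCovers, generate_mem_jointlyEpiCovers]
  constructor
  · intro H Z g h hgh
    refine e.map_injective (H _ _ _ fun i => ?_)
    rw [← e.map_comp, ← e.map_comp, hgh]
  · intro H Z g h hgh
    obtain ⟨g', hg⟩ := e.map_surjective (g ≫ (e.objObjPreimageIso Z).inv)
    obtain ⟨h', hh⟩ := e.map_surjective (h ≫ (e.objObjPreimageIso Z).inv)
    rw [← cancel_mono (e.objObjPreimageIso Z).inv, ← hg, ← hh]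
    refine congrArg e.map (H _ _ _ fun i => e.map_injective ?_)
    rw [e.map_comp, e.map_comp, hg, hh, reassoc_of% (hgh i)]

end JointlyEpi

/-! ### The jointly epimorphic topology via Gabriel–Popescu -/

section Grothendieck

open Limits

variable {C : Type u} [Category.{v} C] [Abelian C] [IsGrothendieckAbelian.{v} C]

open IsGrothendieckAbelian in
/-- In a Grothendieck category, jointly epimorphic families of morphisms from a separator that are
closed under the action of its endomorphism ring are stable under pullback. -/
lemma jointlyEpi_pullback_of_isSeparator {G : C} (hG : IsSeparator G) {X Y : C}
    (J : Submodule (End G)ᵐᵒᵖ ((preadditiveCoyonedaObj G).obj X))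
    (hJ : ∀ (Z : C) (g h : X ⟶ Z), (∀ a : G ⟶ X, a ∈ J → a ≫ g = a ≫ h) → g = h) (f : Y ⟶ X)
    {Z : C} (g h : Y ⟶ Z)
    (hgh : ∀ a : G ⟶ Y, (ModuleCat.Hom.hom ((preadditiveCoyonedaObj G).map f)) a ∈ J →
      a ≫ g = a ≫ h) :
    g = h := by
  have := GabrielPopescu.full G hG
  have : (preadditiveCoyonedaObj G).Faithful :=
    (isSeparator_iff_faithful_preadditiveCoyonedaObj G).1 hG
  have := GabrielPopescu.preservesFiniteLimits G hG
  let U := preadditiveCoyonedaObj G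
  let adj := tensorObjPreadditiveCoyonedaObjAdjunction G
  let ι : ModuleCat.of _ J ⟶ U.obj X := ModuleCat.ofHom J.subtype
  -- Joint epimorphy of `J` says that the morphism adjoint to `ι` is epi. The counit is an
  -- isomorphism because `U` is fully faithful.
  have hepi : Epi ((tensorObj G).map ι) := by
    have : Epi ((tensorObj G).map ι ≫ adj.counit.app X) := by
      refine ⟨fun {Z} g h H => hJ Z g h fun a ha => ?_⟩
      have H' : (tensorObj G).map (ι ≫ U.map g) ≫ adj.counit.app Z =
          (tensorObj G).map (ι ≫ U.map h) ≫ adj.counit.app Z := by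
        have hnat (m : X ⟶ Z) : (tensorObj G).map (U.map m) ≫ adj.counit.app Z =
          adj.counit.app X ≫ m := adj.counit.naturality m
        rw [Functor.map_comp, Functor.map_comp, Category.assoc, Category.assoc, hnat, hnat]
        simpa using H
      have H'' : ι ≫ U.map g = ι ≫ U.map h := (adj.homEquiv _ Z).symm.injective (by
        rw [adj.homEquiv_counit, adj.homEquiv_counit]
        exact H')
      exact congrArg (fun m : ModuleCat.of _ J ⟶ U.obj Z => (ModuleCat.Hom.hom m) ⟨a, ha⟩) H''
    exact (epi_comp_iff_of_isIso _ _).1 this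
  -- Left exactness of the left adjoint preserves this pullback of modules, and epimorphisms in `C`
  -- are stable under pullback.
  have hsq := (IsPullback.of_hasPullback ι (U.map f)).map (tensorObj G)
  have hsnd : Epi ((tensorObj G).map (pullback.snd ι (U.map f))) :=
    Abelian.epi_snd_of_isLimit _ _ hsq.isLimit
  have key : pullback.snd ι (U.map f) ≫ U.map g = pullback.snd ι (U.map f) ≫ U.map h := by
    ext x
    refine hgh _ ?_
    have hx : (ModuleCat.Hom.hom (pullback.fst ι (U.map f) ≫ ι)) x =
      (ModuleCat.Hom.hom (pullback.snd ι (U.map f) ≫ U.map f)) x := by rw [pullback.condition]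
    have hx' := ((ModuleCat.Hom.hom (pullback.fst ι (U.map f))) x : J).2
    exact Set.mem_of_eq_of_mem hx.symm hx'
  have key' := congrArg (tensorObj G).map key
  rw [Functor.map_comp, Functor.map_comp, cancel_epi] at key'
  rw [← cancel_epi (adj.counit.app Y)]
  exact (adj.counit.naturality g).symm.trans
    ((congrArg (· ≫ adj.counit.app Z) key').trans (adj.counit.naturality h))

/-- The topology of jointly epimorphic sieves on a Grothendieck category. -/
def jointlyEpiTopology (k : Type w) [CommRing k] (C : Type u) [Category.{v} C] [Abelian C]
    [IsGrothendieckAbelian.{v} C] [Linear k C] : LinearTopology k C where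
  covers := jointlyEpiCovers k C
  maximal_mem X Z g h H := by simpa using H X (𝟙 X) Submodule.mem_top
  pullback_mem {X Y R} f hR Z g h H := by
    obtain ⟨G, hG⟩ := HasSeparator.hasSeparator (C := C)
    -- The morphisms of `R` from `G` alone are already jointly epimorphic, since `G` is a separator.
    let J : Submodule (End G)ᵐᵒᵖ ((preadditiveCoyonedaObj G).obj X) :=
      { carrier := {a | a ∈ R.arrows G}
        add_mem' := fun ha hb => Submodule.add_mem _ ha hb
        zero_mem' := Submodule.zero_mem _
        smul_mem' := fun r a ha => R.precomp_mem r.unop ha }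
    refine jointlyEpi_pullback_of_isSeparator hG J (fun Z g h H => ?_) f g h fun a ha => H G a ha
    refine hR Z g h fun W r hr => hG.def _ _ fun e => ?_
    have := H (e ≫ r) (R.precomp_mem e hr)
    simpa using this
  glue_mem {X R} S hR hS Z g h H := hR Z g h fun Y f hf => hS Y f hf Z _ _ fun W e he => by
    simpa using H W (e ≫ f) he

end Grothendieck

/-! ### Linear structure on the model with small hom sets -/

section ShrinkHoms

variable (k : Type w) [CommRing k] (C : Type u) [Category.{v} C]

variable [LocallySmall.{v₁} C] [Preadditive C] [Linear k C]

variable {C} in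
/-- The additive bijection between the morphisms in `ShrinkHoms C` and in `C`. -/
noncomputable def shrinkHomsAddEquiv (X Y : ShrinkHoms.{u} C) :
    (X ⟶ Y) ≃+ ((ShrinkHoms.inverse.{v₁} C).obj X ⟶ (ShrinkHoms.inverse.{v₁} C).obj Y) :=
  { (ShrinkHoms.equivalence.{v₁} C).symm.fullyFaithfulFunctor.homEquiv with
    map_add' := fun _ _ => (ShrinkHoms.inverse.{v₁} C).map_add }

variable {C} in
lemma shrinkHomsAddEquiv_apply {X Y : ShrinkHoms.{u} C} (f : X ⟶ Y) :
    shrinkHomsAddEquiv X Y f = (ShrinkHoms.inverse.{v₁} C).map f := rfl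

noncomputable instance : Linear k (ShrinkHoms.{u} C) where
  homModule X Y := AddEquiv.module k (shrinkHomsAddEquiv X Y)
  smul_comp X Y Z r f g := by
    refine (shrinkHomsAddEquiv X Z).injective ?_
    refine Eq.trans ?_ ((shrinkHomsAddEquiv X Z).apply_symm_apply
      (r • shrinkHomsAddEquiv X Z (f ≫ g))).symm
    simp only [shrinkHomsAddEquiv_apply, Functor.map_comp]
    rw [← Linear.smul_comp]
    congr 1
    exact (shrinkHomsAddEquiv X Y).apply_symm_apply _
  comp_smul X Y Z f r g := by
    refine (shrinkHomsAddEquiv X Z).injective ?_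
    refine Eq.trans ?_ ((shrinkHomsAddEquiv X Z).apply_symm_apply
      (r • shrinkHomsAddEquiv X Z (f ≫ g))).symm
    simp only [shrinkHomsAddEquiv_apply, Functor.map_comp]
    rw [← Linear.comp_smul]
    congr 1
    exact (shrinkHomsAddEquiv Y Z).apply_symm_apply _

instance : (ShrinkHoms.inverse.{v₁} C).Linear k where
  map_smul _ _ := (shrinkHomsAddEquiv _ _).apply_symm_apply _

instance : (ShrinkHoms.functor.{v₁} C).Linear k :=
  have : (ShrinkHoms.equivalence.{v₁} C).symm.functor.Linear k :=
    inferInstanceAs ((ShrinkHoms.inverse.{v₁} C).Linear k)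
  have : (ShrinkHoms.equivalence.{v₁} C).symm.functor.Additive :=
    inferInstanceAs (ShrinkHoms.inverse.{v₁} C).Additive
  (ShrinkHoms.equivalence.{v₁} C).symm.inverseLinear k

end ShrinkHoms

/-! ### LC morphisms as dense morphisms -/

section LC

variable {k : Type w} [CommRing k] {A : Type u} [Category.{v} A] [Preadditive A] [Linear k A]
  {C : Type u₁} [Category.{v₁} C] [Preadditive C] [Linear k C]
  {D : Type u₂} [Category.{v₂} D] [Preadditive D] [Linear k D]

/-- An LC morphism, composed with an equivalence, is a dense morphism for the topology of jointly
epimorphic sieves. -/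
lemma IsLCMorphism.isDenseMorphism {T : LinearTopology k A} {F : A ⥤ C} (hF : IsLCMorphism T F)
    {T' : LinearTopology k D} (hT' : T'.covers = jointlyEpiCovers k D) (e : C ⥤ D)
    [e.IsEquivalence] [(F ⋙ e).Additive] [(F ⋙ e).Linear k] :
    IsDenseMorphism T T' (F ⋙ e) := by
  have := hF.additive
  refine IsDenseMorphism.of_covers_iff ?_ ?_ ?_ ?_
  · intro X Y c
    obtain ⟨c, rfl⟩ := e.map_surjective c
    obtain ⟨ι, Y', a, f, hcov, h⟩ := hF.satisfiesLC.satisfiesF X Y c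
    refine T.mem_of_le (LinearSieve.generate_le_iff.2 fun i => ?_) hcov
    refine LinearSieve.mem_lifting.2 ⟨f i, ?_⟩
    rw [Functor.comp_map, Functor.comp_map, ← h, e.map_comp]
  · intro X Y a ha
    have ha' : F.map a = 0 := e.map_injective (by
      have h0 : (F ⋙ e).map (0 : X ⟶ Y) = 0 := Functor.map_zero _ _ _
      rw [← F.map_zero]
      exact ha.trans h0.symm)
    obtain ⟨ι, Y', b, hcov, h⟩ := hF.satisfiesLC.satisfiesFF X Y a ha'
    exact T.mem_of_le (LinearSieve.generate_le_iff.2 fun i => h i) hcov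
  · intro Z
    obtain ⟨ι, Y, f, hf⟩ := hF.satisfiesLC.satisfiesG (e.objPreimage Z)
    have h := (generate_map_mem_jointlyEpiCovers e).2 hf
    rw [generate_mem_jointlyEpiCovers] at h
    rw [hT']
    refine generate_mem_jointlyEpiCovers.2 fun W g g' H => ?_
    rw [← cancel_epi (e.objObjPreimageIso Z).hom]
    refine h _ _ _ fun i => ?_
    simpa using H ⟨Y i, e.map (f i) ≫ (e.objObjPreimageIso Z).hom⟩
  · intro X R
    rw [hF.satisfiesLC.eq_preimage, hT']
    exact (generate_map_mem_jointlyEpiCovers e).symm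

end LC

/-! ### The LC morphism given by a separator -/

section Separator

variable {k : Type w} [CommRing k] {C : Type u} [Category.{v} C] [Preadditive C] [Linear k C]

/-- The full subcategory on a single object, as a small category. -/
abbrev OneObject (G : C) : Type v := InducedCategory C (fun _ : PUnit.{v + 1} => G)

instance (G : C) : (inducedFunctor (fun _ : PUnit.{v + 1} => G)).Linear k where

lemma ofImage_oneObject_mem {G : C} (hG : IsSeparator G) {T : LinearTopology k C}
    (hT : T.covers = jointlyEpiCovers k C) (Z : C) :
    LinearSieve.ofImage k (inducedFunctor (fun _ : PUnit.{v + 1} => G)) Z ∈ T.covers Z := by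
  rw [hT]
  exact generate_mem_jointlyEpiCovers.2 fun W g h H => hG.def _ _ fun a => H ⟨PUnit.unit, a⟩

/-- The functor is fully faithful, so (F) and (FF) hold on the cover by an identity; (G) is the
separator property carried over by `e`. -/
lemma isLCMorphism_oneObject {D : Type u₁} [Category.{v₁} D] [Preadditive D] [Linear k D]
    {G : C} (hG : IsSeparator G) {T : LinearTopology k C} (hT : T.covers = jointlyEpiCovers k C)
    (e : C ⥤ D) [e.IsEquivalence] [e.Additive] [e.Linear k] :
    IsLCMorphism (T.induced (inducedFunctor (fun _ : PUnit.{v + 1} => G))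
      (ofImage_oneObject_mem hG hT)) (inducedFunctor (fun _ : PUnit.{v + 1} => G) ⋙ e) where
  additive := inferInstance
  linear := inferInstance
  satisfiesLC :=
    { satisfiesG := fun X => by
        refine ⟨ULift.{max v v₁} (G ⟶ e.objPreimage X), fun _ => PUnit.unit,
          fun a => e.map a.down ≫ (e.objObjPreimageIso X).hom, ?_⟩
        refine generate_mem_jointlyEpiCovers.2 fun Z g h H => ?_
        rw [← cancel_epi (e.objObjPreimageIso X).hom]
        have key : LinearSieve.generate k (fun _ : (G ⟶ e.objPreimage X) => G) (fun a => a) ∈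
            jointlyEpiCovers k C _ :=
          generate_mem_jointlyEpiCovers.2 fun Z g h H => hG.def _ _ H
        refine generate_mem_jointlyEpiCovers.1 ((generate_map_mem_jointlyEpiCovers e).2 key)
          _ _ _ fun a => ?_
        simpa using H ⟨a⟩
      satisfiesF := fun X X' c => by
        refine ⟨PUnit, fun _ => X, fun _ => 𝟙 X,
          fun _ => (inducedFunctor (fun _ : PUnit.{v + 1} => G) ⋙ e).preimage c,
          LinearTopology.of_id_mem _ (LinearSieve.mem_generate _ _ PUnit.unit), fun _ => ?_⟩
        rw [Functor.map_preimage]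
        exact (congrArg (· ≫ c) (CategoryTheory.Functor.map_id _ X)).trans (Category.id_comp c)
      satisfiesFF := fun X X' a ha => by
        have ha' : a = 0 := (inducedFunctor (fun _ : PUnit.{v + 1} => G) ⋙ e).map_injective
          (ha.trans (Functor.map_zero _ _ _).symm)
        exact ⟨PUnit, fun _ => X, fun _ => 𝟙 X,
          LinearTopology.of_id_mem _ (LinearSieve.mem_generate _ _ PUnit.unit),
          fun _ => by rw [ha', Limits.comp_zero]⟩
      eq_preimage := by
        funext X
        ext R
        change R.map _ ∈ T.covers _ ↔ _
        rw [hT]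
        exact (generate_map_mem_jointlyEpiCovers e).symm }

end Separator

/-- Every Grothendieck category receives an LC morphism from a small linear site. -/
lemma exists_isLCMorphism (k : Type w) [CommRing k] (C : Type u₁) [Category.{v₁} C] [Abelian C]
    [IsGrothendieckAbelian.{w} C] [Linear k C] :
    ∃ (A : Type w) (_ : SmallCategory A) (_ : Preadditive A) (_ : Linear k A)
      (T : LinearTopology k A) (F : A ⥤ C), IsLCMorphism T F := by
  obtain ⟨G, hG⟩ := HasSeparator.hasSeparator (C := ShrinkHoms.{u₁} C)
  exact ⟨OneObject G, inferInstance, inferInstance, inferInstance, _, _,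
    isLCMorphism_oneObject hG (T := jointlyEpiTopology k (ShrinkHoms.{u₁} C)) rfl
      (ShrinkHoms.inverse.{w} C)⟩

/-- The sheaf category of a tensor product of small sites with LC morphisms to `C` and `D` is that
of the tensor product of `C` and `D` with their topologies of jointly epimorphic sieves. -/
lemma linearlyEquivalent_sh_tensor (k : Type w) [CommRing k]
    (C : Type u₁) [Category.{v₁} C] [Abelian C] [IsGrothendieckAbelian.{w} C] [Linear k C]
    (D : Type u₂) [Category.{v₂} D] [Abelian D] [IsGrothendieckAbelian.{w} D] [Linear k D]
    {A : Type w} [SmallCategory A] [Preadditive A] [Linear k A]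
    {B : Type w} [SmallCategory B] [Preadditive B] [Linear k B]
    {TA : LinearTopology k A} {TB : LinearTopology k B} {F : A ⥤ C} {G : B ⥤ D}
    (hF : IsLCMorphism TA F) (hG : IsLCMorphism TB G) :
    LinearlyEquivalent k
      (Sh ((jointlyEpiTopology k (ShrinkHoms.{u₁} C)).tensor
        (jointlyEpiTopology k (ShrinkHoms.{u₂} D)))) (Sh (TA.tensor TB)) := by
  have := hF.additive
  have := hF.linear
  have := hG.additive
  have := hG.linear
  exact ((hF.isDenseMorphism (T' := jointlyEpiTopology k (ShrinkHoms.{u₁} C)) rfl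
    (ShrinkHoms.functor.{w} C)).tensor
    (hG.isDenseMorphism (T' := jointlyEpiTopology k (ShrinkHoms.{u₂} D)) rfl
    (ShrinkHoms.functor.{w} D))).linearlyEquivalent

end LinSite

theorem mainTheorem2 (k : Type w) [CommRing k]
    (C : Type u₁) [Category.{v₁} C] [Abelian C] [IsGrothendieckAbelian.{w} C] [Linear k C]
    (D : Type u₂) [Category.{v₂} D] [Abelian D] [IsGrothendieckAbelian.{w} D] [Linear k D] :
    (∀ (A : Type w) [SmallCategory A] [Preadditive A] [Linear k A]
      (A' : Type w) [SmallCategory A'] [Preadditive A'] [Linear k A']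
      (B : Type w) [SmallCategory B] [Preadditive B] [Linear k B]
      (B' : Type w) [SmallCategory B'] [Preadditive B'] [Linear k B']
      (TA : LinSite.LinearTopology k A) (TA' : LinSite.LinearTopology k A')
      (TB : LinSite.LinearTopology k B) (TB' : LinSite.LinearTopology k B')
      (F : A ⥤ C) (F' : A' ⥤ C) (G : B ⥤ D) (G' : B' ⥤ D),
      LinSite.IsLCMorphism TA F → LinSite.IsLCMorphism TA' F' →
      LinSite.IsLCMorphism TB G → LinSite.IsLCMorphism TB' G' →
      LinSite.LinearlyEquivalent k
        (LinSite.Sh (TA.tensor TB)) (LinSite.Sh (TA'.tensor TB'))) ∧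
    (∃ (E : Type (w + 1)) (_ : Category.{w} E) (_ : Preadditive E) (_ : Linear k E),
      LinSite.IsTensorProduct k C D E) ∧
    (∀ (E : Type u₃) [Category.{v₃} E] [Preadditive E] [Linear k E]
      (E' : Type u₄) [Category.{v₄} E'] [Preadditive E'] [Linear k E'],
      LinSite.IsTensorProduct k C D E → LinSite.IsTensorProduct k C D E' →
      LinSite.LinearlyEquivalent k E E') := by
  -- Both sides are compared with sheaves on the tensor product of `C` and `D` themselves, so no
  -- functor between the two pairs of sites is needed.
  have key {A : Type w} [SmallCategory A] [Preadditive A] [Linear k A]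
      {B : Type w} [SmallCategory B] [Preadditive B] [Linear k B]
      {A' : Type w} [SmallCategory A'] [Preadditive A'] [Linear k A']
      {B' : Type w} [SmallCategory B'] [Preadditive B'] [Linear k B']
      {TA : LinSite.LinearTopology k A} {TB : LinSite.LinearTopology k B}
      {TA' : LinSite.LinearTopology k A'} {TB' : LinSite.LinearTopology k B'}
      {F : A ⥤ C} {F' : A' ⥤ C} {G : B ⥤ D} {G' : B' ⥤ D}
      (hF : LinSite.IsLCMorphism TA F) (hF' : LinSite.IsLCMorphism TA' F')
      (hG : LinSite.IsLCMorphism TB G) (hG' : LinSite.IsLCMorphism TB' G') :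
      LinSite.LinearlyEquivalent k (LinSite.Sh (TA.tensor TB)) (LinSite.Sh (TA'.tensor TB')) :=
    LinSite.linearlyEquivalent_trans
      (LinSite.linearlyEquivalent_symm (LinSite.linearlyEquivalent_sh_tensor k C D hF hG))
      (LinSite.linearlyEquivalent_sh_tensor k C D hF' hG')
  refine ⟨?_, ?_, ?_⟩
  · intro A _ _ _ A' _ _ _ B _ _ _ B' _ _ _ TA TA' TB TB' F F' G G' hF hF' hG hG'
    exact key hF hF' hG hG'
  · obtain ⟨A, _, _, _, TA, F, hF⟩ := LinSite.exists_isLCMorphism k C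
    obtain ⟨B, _, _, _, TB, G, hG⟩ := LinSite.exists_isLCMorphism k D
    exact ⟨LinSite.Sh (TA.tensor TB), inferInstance, inferInstance, inferInstance,
      A, _, _, _, B, _, _, _, TA, TB, F, G, hF, hG,
      CategoryTheory.Equivalence.refl, inferInstanceAs (𝟭 _).Additive,
      inferInstanceAs ((𝟭 _).Linear k)⟩
  · intro E _ _ _ E' _ _ _ hE hE'
    obtain ⟨A, _, _, _, B, _, _, _, TA, TB, F, G, hF, hG, hE⟩ := hE
    obtain ⟨A', _, _, _, B', _, _, _, TA', TB', F', G', hF', hG', hE'⟩ := hE'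
    exact LinSite.linearlyEquivalent_trans hE (LinSite.linearlyEquivalent_trans
      (key hF hF' hG hG') (LinSite.linearlyEquivalent_symm hE'))
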